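/- Let $M$ be a smooth ($C^\infty$) 3-manifold without boundary and let $f : M \to \mathbb{C}^3$ be a smooth embedding. For $x \in M$ write $T_x = df_x(T_xM) \subset \mathbb{C}^3 \cong \mathbb{R}^6$, and let $J$ denote multiplication by $i$. A point $x$ is a complex tangent of $f$ if $T_x \cap J(T_x) \neq \{0\}$, and $f$ is totally real if it has no complex tangents. Then for every $\varepsilon > 0$ there is a rotation $l \in SO(6)$ of $\mathbb{C}^3 \cong \mathbb{R}^6$ with $\|l - \mathrm{id}\| < \varepsilon$ (operator norm) such that the smooth embedding $l \circ f$ is either totally real, or its set of complex tangents is a nonempty embedded smooth submanifold of $M$ of dimension one, that is, a smooth curve or a disjoint union of smooth curves. -/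

import Mathlib

open scoped Manifold ContDiff

/-- Complex three-space with its standard Hermitian norm. As a real normed space it is the
Euclidean space of dimension six. -/
abbrev C3 : Type := EuclideanSpace ℂ (Fin 3)

/-- The complex structure of `ℂ³`: multiplication by `i`, as a real linear map. -/
noncomputable def mulI : C3 →ₗ[ℝ] C3 where
  toFun v := Complex.I • v
  map_add' v w := smul_add _ v w
  map_smul' r v := smul_comm _ r v

/-- A real linear isometry of `ℂ³ = ℝ⁶` that preserves the orientation, that is, an element of
`SO(6)`. -/
def IsRotation (l : C3 ≃ₗᵢ[ℝ] C3) : Prop :=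
  LinearMap.det (l.toLinearEquiv : C3 →ₗ[ℝ] C3) = 1

section

variable {M : Type*} [TopologicalSpace M] [ChartedSpace (EuclideanSpace ℝ (Fin 3)) M]

/-- The tangent space at `x` of a 3-manifold mapped to `ℂ³` by `f`, as a real subspace of `ℂ³`. -/
noncomputable def tangentPlane (f : M → C3) (x : M) : Submodule ℝ C3 :=
  LinearMap.range (mfderiv (𝓡 3) 𝓘(ℝ, C3) f x : EuclideanSpace ℝ (Fin 3) →L[ℝ] C3).toLinearMap

/-- The set of complex tangents of `f`: the points `x` with `T ∩ J T ≠ {0}`, where `T` is the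
tangent space at `x`. -/
def complexTangents (f : M → C3) : Set M :=
  {x | tangentPlane f x ⊓ (tangentPlane f x).map mulI ≠ ⊥}

/-- The map `f` is totally real: it has no complex tangents. -/
def IsTotallyReal (f : M → C3) : Prop :=
  complexTangents f = ∅

/-- `S` is an embedded smooth submanifold of dimension one of the smooth 3-manifold `M` (a disjoint
union of smooth curves): near each of its points, `S` is the first coordinate axis in some smooth
chart of `M`. -/
def IsSmoothCurveIn (S : Set M) : Prop :=
  ∀ x ∈ S, ∃ φ ∈ IsManifold.maximalAtlas (𝓡 3) ∞ M, x ∈ φ.source ∧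
    ∀ y ∈ φ.source, y ∈ S ↔ φ y 1 = 0 ∧ φ y 2 = 0

end

/-! In a chart the tangent spaces of `f` have a smooth real frame `v`, and by `cdet_eq_zero_iff` a
point is a complex tangent exactly where the complex determinant `cdet` of the frame vanishes. After
a rotation `A` the complex tangents are locally the zeros of the determinant of the rotated frame, a
map from ℝ³ to ℂ. If that map is submersive at its zeros, they form a curve
(`exists_straightening`). It is enough to find `A` near the identity for which this holds in
countably many charts covering `M`.

Rotations have enough freedom: if a tangent space contains the complex line of `u`, turning `u`
towards complex multiples of a vector `n` outside the complex span of the tangent space moves the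
determinant in every direction of ℂ (`surjective_fderiv_cdet_exp`). So a two-parameter family of
rotations is submersive in the parameter alone, and by parametric transversality
(`volume_image_singularZeros_eq_zero`) the parameters with a degenerate zero form a null set. That
theorem rests on Sard's theorem in the plane, Fubini and a Hausdorff measure estimate.

Nullity in the families becomes a Baire statement: near a zero, the rotations with a degenerate zero
lie in a closed set, and an interior point of it would yield a whole neighbourhood of bad parameters
(`exists_nhds_isNowhereDense_degenerate`). Countably many such sets suffice, so the good rotations
are residual, hence dense in the complete space of rotations. -/

/-! ### Sard's theorem on a plane, by Hausdorff measure -/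

section Sard

open MeasureTheory MeasureTheory.Measure Set Filter Topology Module

/-- A correspondence that is Hölder of exponent `n` maps sets that are null in dimension `n * d`
to sets that are null in dimension `d`. -/
theorem hausdorffMeasure_image_eq_zero_of_dist_le {ι X Y : Type*}
    [MetricSpace X] [MeasurableSpace X] [BorelSpace X]
    [MetricSpace Y] [MeasurableSpace Y] [BorelSpace Y]
    {S : Set ι} {a : ι → X} {b : ι → Y} {C : ℝ} {n : ℕ} (hn : n ≠ 0) {d : ℝ} (hd : 0 ≤ d)
    (h : ∀ i ∈ S, ∀ j ∈ S, dist (b i) (b j) ≤ C * dist (a i) (a j) ^ n)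
    (h0 : μH[n * d] (a '' S) = 0) : μH[d] (b '' S) = 0 := by
  classical
  rcases S.eq_empty_or_nonempty with rfl | ⟨i0, -⟩
  · simp
  have : Nonempty ι := ⟨i0⟩
  set r : X → ι := Function.invFunOn a S
  have hr : ∀ x ∈ a '' S, r x ∈ S ∧ a (r x) = x := fun x hx ↦
    ⟨Function.invFunOn_mem hx, Function.invFunOn_eq hx⟩
  have hC : C ≤ C.toNNReal := Real.le_coe_toNNReal C
  have hold : HolderOnWith C.toNNReal n (b ∘ r) (a '' S) := by
    intro x hx y hy
    have h1 := h _ (hr x hx).1 _ (hr y hy).1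
    rw [(hr x hx).2, (hr y hy).2] at h1
    have h2 : dist (b (r x)) (b (r y)) ≤ C.toNNReal * dist x y ^ n :=
      h1.trans (by gcongr)
    have h3 : nndist (b (r x)) (b (r y)) ≤ C.toNNReal * nndist x y ^ n := by
      rw [← NNReal.coe_le_coe]; push_cast; exact h2
    simp only [Function.comp_apply, edist_nndist, NNReal.coe_natCast, ENNReal.rpow_natCast]
    exact_mod_cast h3
  -- Indices with the same `a` have the same `b`, because `0 ^ n = 0` for `n ≠ 0`; so the choice of
  -- section `r` loses nothing.
  have hsub : b '' S ⊆ (b ∘ r) '' (a '' S) := by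
    rintro _ ⟨i, hi, rfl⟩
    refine ⟨a i, mem_image_of_mem _ hi, ?_⟩
    have hi' := hr (a i) (mem_image_of_mem _ hi)
    have h1 := h _ hi'.1 _ hi
    rw [hi'.2, dist_self, zero_pow hn, mul_zero] at h1
    exact dist_le_zero.1 h1
  refine measure_mono_null hsub (le_antisymm ?_ zero_le)
  refine (hold.hausdorffMeasure_image_le (by positivity) hd).trans ?_
  simp [h0]

/-- Null images are detected locally. -/
theorem measure_image_eq_zero_of_locally {X Y : Type*} [TopologicalSpace X]
    [SecondCountableTopology X] [MeasurableSpace Y] (μ : Measure Y) (g : X → Y) {S : Set X}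
    (h : ∀ x ∈ S, ∃ t ∈ 𝓝 x, μ (g '' (S ∩ t)) = 0) : μ (g '' S) = 0 := by
  choose! t ht hμ using h
  obtain ⟨c, hcS, hc, hcov⟩ := TopologicalSpace.countable_cover_nhdsWithin
    (f := fun x ↦ S ∩ t x) (s := S)
    (fun x hx ↦ inter_mem self_mem_nhdsWithin (mem_nhdsWithin_of_mem_nhds (ht x hx)))
  refine measure_mono_null (image_mono hcov) ?_
  rw [image_iUnion₂]
  exact (measure_biUnion_null_iff hc).2 fun x hx ↦ hμ x (hcS hx)

variable {E F : Type*} [NormedAddCommGroup E] [NormedSpace ℝ E]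
  [NormedAddCommGroup F] [NormedSpace ℝ F]

/-- A `C^1` function is Lipschitz on a small ball around each point. -/
theorem ContDiffOn.exists_ball_norm_sub_le {f : E → F} {U : Set E} (hU : IsOpen U)
    (hf : ContDiffOn ℝ 1 f U) {x : E} (hx : x ∈ U) :
    ∃ C, 0 ≤ C ∧ ∃ r > 0, Metric.ball x r ⊆ U ∧
      ∀ y ∈ Metric.ball x r, ∀ z ∈ Metric.ball x r, ‖f z - f y‖ ≤ C * ‖z - y‖ := by
  obtain ⟨K, t, ht, hK⟩ := (hf.contDiffAt (hU.mem_nhds hx)).exists_lipschitzOnWith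
  obtain ⟨r, hr, hrt⟩ := Metric.mem_nhds_iff.1 (inter_mem ht (hU.mem_nhds hx))
  refine ⟨K, K.2, r, hr, fun y hy ↦ (hrt hy).2, fun y hy z hz ↦ ?_⟩
  simpa [dist_eq_norm] using hK.dist_le_mul z (hrt hz).1 y (hrt hy).1

/-- If the derivative of `f` grows like the `n`-th power of the distance from `y`, then `f` is
close to its value at `y` to order `n + 1`. -/
theorem norm_sub_le_pow_succ {f : E → F} {B : Set E} (hB : Convex ℝ B)
    (hf : ∀ z ∈ B, DifferentiableAt ℝ f z) {C : ℝ} (hC : 0 ≤ C) {y : E} (hy : y ∈ B) {n : ℕ}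
    (h : ∀ z ∈ B, ‖fderiv ℝ f z‖ ≤ C * ‖z - y‖ ^ n) {z : E} (hz : z ∈ B) :
    ‖f z - f y‖ ≤ C * ‖z - y‖ ^ (n + 1) := by
  have hseg : segment ℝ y z ⊆ B := hB.segment_subset hy hz
  have := (convex_segment (𝕜 := ℝ) y z).norm_image_sub_le_of_norm_fderiv_le (𝕜 := ℝ) (f := f)
    (C := C * ‖z - y‖ ^ n)
    (fun w hw ↦ hf w (hseg hw)) (fun w hw ↦ (h w (hseg hw)).trans ?_)
    (left_mem_segment ℝ y z) (right_mem_segment ℝ y z)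
  · calc _ ≤ _ := this
      _ = _ := by ring
  · gcongr
    obtain ⟨a, b, ha, hb, hab, rfl⟩ := hw
    have h1 : a • y + b • z - y = b • (z - y) := by
      have : a = 1 - b := by linarith
      subst this
      module
    rw [h1, norm_smul, Real.norm_of_nonneg hb]
    exact mul_le_of_le_one_left (norm_nonneg _) (by linarith)

/-- Sard's theorem for real functions of class `C^3` on a plane. -/
theorem volume_image_critical_eq_zero [FiniteDimensional ℝ E] (hE : finrank ℝ E = 2)
    {h : E → ℝ} {U : Set E} (hU : IsOpen U) (hh : ContDiffOn ℝ 3 h U) :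
    volume (h '' {x ∈ U | fderiv ℝ h x = 0}) = 0 := by
  borelize E
  have hD : ∀ x ∈ U, DifferentiableAt ℝ h x := fun x hx ↦
    (hh.contDiffAt (hU.mem_nhds hx)).differentiableAt (by simp)
  have hh1 : ContDiffOn ℝ 2 (fderiv ℝ h) U := hh.fderiv_of_isOpen hU (by norm_num)
  have hD1 : ∀ x ∈ U, DifferentiableAt ℝ (fderiv ℝ h) x := fun x hx ↦
    (hh1.contDiffAt (hU.mem_nhds hx)).differentiableAt (by simp)
  have hh2 : ContDiffOn ℝ 1 (fderiv ℝ (fderiv ℝ h)) U :=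
    hh1.fderiv_of_isOpen hU (by norm_num)
  set S := {x ∈ U | fderiv ℝ h x = 0}
  have hS : S = {x ∈ S | fderiv ℝ (fderiv ℝ h) x = 0} ∪
      {x ∈ S | fderiv ℝ (fderiv ℝ h) x ≠ 0} := by
    ext x; simp; tauto
  rw [← hausdorffMeasure_real, hS, image_union]
  refine measure_union_null ?_ ?_
  · refine measure_image_eq_zero_of_locally _ _ fun x hx ↦ ?_
    obtain ⟨C, hC, r, hr, hrU, hl⟩ := hh2.exists_ball_norm_sub_le hU hx.1.1
    refine ⟨_, Metric.ball_mem_nhds x hr, ?_⟩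
    -- Where the second derivative vanishes too, integrating its Lipschitz bound twice gives order
    -- 3, and the plane is null in dimension 3.
    refine hausdorffMeasure_image_eq_zero_of_dist_le (a := id) (C := C) (n := 3) (by simp)
      zero_le_one ?_ ?_
    · rintro z ⟨⟨-, -⟩, hzr⟩ y ⟨⟨⟨-, hy1⟩, hy2⟩, hyr⟩
      rw [dist_eq_norm, dist_eq_norm]
      refine norm_sub_le_pow_succ (convex_ball x r) (fun w hw ↦ hD w (hrU hw)) hC hyr
        (fun w hw ↦ ?_) hzr
      have := norm_sub_le_pow_succ (f := fderiv ℝ h) (n := 1) (convex_ball x r)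
        (fun w hw ↦ hD1 w (hrU hw)) hC hyr
        (fun v hv ↦ by simpa [hy2] using hl y hyr v hv) hw
      simpa [hy1] using this
    · rw [Real.hausdorffMeasure_of_finrank_lt (by rw [hE]; norm_num)]
      simp
  · refine measure_image_eq_zero_of_locally _ _ fun x hx ↦ ?_
    obtain ⟨w, hw⟩ : ∃ w, fderiv ℝ (fderiv ℝ h) x w ≠ 0 := by
      by_contra! hcon
      exact hx.2 (ContinuousLinearMap.ext hcon)
    obtain ⟨w', hw'⟩ : ∃ w', fderiv ℝ (fderiv ℝ h) x w w' ≠ 0 := by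
      by_contra! hcon
      exact hw (ContinuousLinearMap.ext hcon)
    set k : E → ℝ := fun y ↦ fderiv ℝ h y w'
    set k' : E →L[ℝ] ℝ := (ContinuousLinearMap.apply ℝ ℝ w').comp (fderiv ℝ (fderiv ℝ h) x)
    have hk : HasStrictFDerivAt k k' x := by
      have h1 := (hh1.contDiffAt (hU.mem_nhds hx.1.1)).hasStrictFDerivAt (by simp)
      exact (ContinuousLinearMap.apply ℝ ℝ w').hasStrictFDerivAt.comp x h1
    have hk' : k' ≠ 0 := fun h0 ↦ hw' (by simpa [k'] using DFunLike.congr_fun h0 w)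
    -- a functional that is injective on the kernel of the derivative
    obtain ⟨q, hq⟩ : ∃ q : E →L[ℝ] ℝ, ∀ z, k' z = 0 → q z = 0 → z = 0 := by
      have hker : finrank ℝ k'.ker = 1 := by
        have h1 := k'.toLinearMap.finrank_range_add_finrank_ker
        have h2 : k'.range = ⊤ :=
          LinearMap.range_eq_top.2 (LinearMap.surjective fun h0 ↦ hk'
            (ContinuousLinearMap.coe_injective h0))
        rw [h2, hE] at h1
        simp at h1
        change finrank ℝ k'.ker = 1
        omega
      obtain ⟨e, he0, he⟩ := finrank_eq_one_iff'.1 hker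
      obtain ⟨q, hqe⟩ := SeparatingDual.exists_ne_zero (R := ℝ) (x := (e : E)) (by simpa using he0)
      refine ⟨q, fun z hz hqz ↦ ?_⟩
      obtain ⟨c, hc⟩ := he ⟨z, hz⟩
      have hc' : c • (e : E) = z := congrArg Subtype.val hc
      rw [← hc', map_smul, smul_eq_mul, mul_eq_zero, or_iff_left hqe] at hqz
      rw [← hc', hqz, zero_smul]
    obtain ⟨K, hK0, hK⟩ := (k'.prod q).toLinearMap.exists_antilipschitzWith (by
      rw [LinearMap.ker_eq_bot']
      intro z hz
      simp only [ContinuousLinearMap.coe_coe, ContinuousLinearMap.prod_apply,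
        Prod.mk_eq_zero] at hz
      exact hq z hz.1 hz.2)
    have hK' : ∀ z, ‖z‖ ≤ K * max ‖k' z‖ ‖q z‖ := fun z ↦ by
      simpa [Prod.dist_eq] using hK.le_mul_dist z 0
    -- With this error, two zeros of `k` at which `k'` dominated the maximum would satisfy `‖z - y‖
    -- ≤ ‖z - y‖ / 2`. So `q` controls the distance along the critical set.
    have hc0 : 0 < (2 * K)⁻¹ := by positivity
    obtain ⟨s, hs, hks⟩ := hk.approximates_deriv_on_nhds (Or.inr hc0)
    obtain ⟨C, hC, r, hr, hrU, hl⟩ := (hh1.of_le one_le_two).exists_ball_norm_sub_le hU hx.1.1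
    refine ⟨_, inter_mem hs (Metric.ball_mem_nhds x hr), ?_⟩
    -- The critical set is now parametrized by a line, so order 2 is enough: the line is null in
    -- dimension 2.
    refine hausdorffMeasure_image_eq_zero_of_dist_le (a := q) (C := C * K ^ 2) (n := 2) (by simp)
      zero_le_one ?_ ?_
    · rintro z ⟨⟨⟨-, hz1⟩, -⟩, hzs, hzr⟩ y ⟨⟨⟨-, hy1⟩, -⟩, hys, hyr⟩
      have h1 : ‖z - y‖ ≤ K * ‖q z - q y‖ := by
        have h2 := hks z hzs y hys
        simp only [k, hz1, hy1, _root_.zero_apply, sub_zero, zero_sub,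
          norm_neg] at h2
        have h3 := hK' (z - y)
        rw [map_sub q] at h3
        rcases max_cases ‖k' (z - y)‖ ‖q z - q y‖ with ⟨h4, -⟩ | ⟨h4, -⟩
        · rw [h4] at h3
          have h5 : ‖z - y‖ ≤ K * (((2 * K)⁻¹ : NNReal) * ‖z - y‖) :=
            h3.trans (by gcongr)
          have h6 : (K : ℝ) * (((2 * K)⁻¹ : NNReal) * ‖z - y‖) = ‖z - y‖ / 2 := by
            have : (K : ℝ) ≠ 0 := by exact_mod_cast hK0.ne'
            push_cast
            field_simp
          have h7 : ‖z - y‖ ≤ 0 := by linarith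
          exact h7.trans (by positivity)
        · rwa [h4] at h3
      rw [dist_eq_norm, dist_eq_norm]
      calc ‖h z - h y‖ ≤ C * ‖z - y‖ ^ 2 :=
            norm_sub_le_pow_succ (convex_ball x r) (fun w hw ↦ hD w (hrU hw)) hC hyr
              (fun w hw ↦ by simpa [hy1] using hl y hyr w hw) hzr
        _ ≤ C * (K * ‖q z - q y‖) ^ 2 := by gcongr
        _ = _ := by ring
    · rw [Real.hausdorffMeasure_of_finrank_lt (by simp)]
      simp

end Sard

/-! ### Parametric transversality with two parameters -/

section Transversality

open MeasureTheory MeasureTheory.Measure Set Filter Topology Module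

/-- A right inverse `R` of `A` makes `B ∘ R` invertible for `B` near `A`, because units are open. -/
theorem ContinuousLinearMap.isOpen_setOf_surjective {E F : Type*} [NormedAddCommGroup E]
    [NormedSpace ℝ E] [NormedAddCommGroup F] [NormedSpace ℝ F] [FiniteDimensional ℝ F] :
    IsOpen {A : E →L[ℝ] F | Function.Surjective A} := by
  have : CompleteSpace F := FiniteDimensional.complete ℝ F
  refine isOpen_iff_mem_nhds.2 fun A hA ↦ ?_
  obtain ⟨R, hR⟩ := A.toLinearMap.exists_rightInverse_of_surjective (LinearMap.range_eq_top.2 hA)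
  let R' : F →L[ℝ] E := R.toContinuousLinearMap
  have hcont : Continuous fun B : E →L[ℝ] F ↦ B.comp R' := by fun_prop
  have hAR : A.comp R' = 1 := ContinuousLinearMap.ext fun y ↦ DFunLike.congr_fun hR y
  have h1 : {B : E →L[ℝ] F | IsUnit (B.comp R')} ∈ 𝓝 A :=
    (Units.isOpen.preimage hcont).mem_nhds (by simp [hAR])
  filter_upwards [h1] with B hB y
  obtain ⟨u, hu⟩ := hB
  refine ⟨R' (u.inv y), ?_⟩
  have h2 : (u.val * u.inv) y = y := by rw [u.val_inv]; rfl
  rw [hu] at h2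
  exact h2

/-- The linear map that adds a multiple of `e` in the parameter direction. -/
noncomputable def lineMap (E : Type*) [NormedAddCommGroup E] [NormedSpace ℝ E] (e : ℝ × ℝ) :
    ℝ × E →L[ℝ] (ℝ × ℝ) × E :=
  (ContinuousLinearMap.toSpanSingleton ℝ e).prodMap (ContinuousLinearMap.id ℝ E)

theorem lineMap_apply {E : Type*} [NormedAddCommGroup E] [NormedSpace ℝ E] (e : ℝ × ℝ)
    (w : ℝ × E) : lineMap E e w = (w.1 • e, w.2) := rfl

variable {W Y : Type*} [NormedAddCommGroup W] [NormedSpace ℝ W] [FiniteDimensional ℝ W]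
  [NormedAddCommGroup Y] [NormedSpace ℝ Y] [FiniteDimensional ℝ Y]

/-- Sard's theorem for the restriction of a linear form to a level surface. -/
theorem volume_image_level_critical_eq_zero (hWY : finrank ℝ W = finrank ℝ Y + 2)
    (l : W →L[ℝ] ℝ) {H : W → Y} {N : Set W} (hN : IsOpen N) (hH : ContDiffOn ℝ 3 H N) :
    volume (l '' {w ∈ N | H w = 0 ∧ Function.Surjective (fderiv ℝ H w) ∧
      ∀ k, fderiv ℝ H w k = 0 → l k = 0}) = 0 := by
  have : CompleteSpace W := FiniteDimensional.complete ℝ W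
  have : CompleteSpace Y := FiniteDimensional.complete ℝ Y
  refine measure_image_eq_zero_of_locally _ _ fun w₀ hw₀ ↦ ?_
  obtain ⟨hw₀N, hH0, hsurj, -⟩ := hw₀
  have hat : ContDiffAt ℝ 3 H w₀ := hH.contDiffAt (hN.mem_nhds hw₀N)
  have hst : HasStrictFDerivAt H (fderiv ℝ H w₀) w₀ := hat.hasStrictFDerivAt (by norm_num)
  let K : Submodule ℝ W := (fderiv ℝ H w₀).ker
  let φ : ImplicitFunctionData ℝ W Y K := hst.implicitFunctionDataOfComplemented H
    (fderiv ℝ H w₀) (LinearMap.range_eq_top.2 hsurj)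
    (ContinuousLinearMap.ker_closedComplemented_of_finiteDimensional_range _)
  have hK : finrank ℝ K = 2 := by
    have h1 := (fderiv ℝ H w₀).toLinearMap.finrank_range_add_finrank_ker
    rw [LinearMap.range_eq_top.2 hsurj, hWY, finrank_top] at h1
    change finrank ℝ (fderiv ℝ H w₀).toLinearMap.ker = 2
    omega
  have hleft : φ.leftFun = H := rfl
  have hpt : φ.pt = w₀ := rfl
  have hright : ContDiff ℝ 3 φ.rightFun := by
    change ContDiff ℝ 3 fun x ↦ _
    simp only [φ, HasStrictFDerivAt.implicitFunctionDataOfComplemented]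
    fun_prop
  have hsm := φ.contDiffAt_implicitFunction (n := 3) (by rwa [hleft, hpt]) hright.contDiffAt
    (by norm_num)
  have hp0 : φ.prodFun φ.pt = (0, φ.rightFun w₀) := by
    rw [φ.prodFun_apply, hleft, hpt, hH0]
  rw [hp0] at hsm
  -- `γ` parametrizes the level surface by the plane `K`. Its differential takes values in the
  -- kernel of that of `H`, so the points in question become critical points of `l ∘ γ`.
  let γ : K → W := fun k ↦ φ.implicitFunction 0 k
  have hγ : ContDiffAt ℝ 3 γ (φ.rightFun w₀) :=
    hsm.comp (φ.rightFun w₀) (f := fun k : K ↦ ((0 : Y), k)) (by fun_prop)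
  have hγ0 : γ (φ.rightFun w₀) = w₀ := by
    have := φ.implicitFunction_apply_image.self_of_nhds
    rwa [hleft, hpt, hH0] at this
  have hHγ : ∀ᶠ k in 𝓝 (φ.rightFun w₀), H (γ k) = 0 := by
    have h1 := φ.leftFun_implicitFunction
    rw [hp0] at h1
    exact (Continuous.prodMk_right (0 : Y)).tendsto (φ.rightFun w₀) |>.eventually h1
  have hγN : ∀ᶠ k in 𝓝 (φ.rightFun w₀), γ k ∈ N :=
    hγ.continuousAt (by rw [hγ0]; exact hN.mem_nhds hw₀N)
  have hsm' : ∀ᶠ k in 𝓝 (φ.rightFun w₀), ContDiffAt ℝ 3 γ k := hγ.eventually (by simp)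
  obtain ⟨V, hVsub, hV, hV0⟩ := mem_nhds_iff.1 (hHγ.and (hγN.and hsm'))
  have hcrit := volume_image_critical_eq_zero hK (h := fun k ↦ l (γ k)) hV
    (fun k hk ↦ (l.contDiff.contDiffAt.comp k (hVsub hk).2.2).contDiffWithinAt)
  have hnear : ∀ᶠ w in 𝓝 w₀, φ.implicitFunction (H w) (φ.rightFun w) = w :=
    φ.implicitFunction_apply_image
  have hnearV : ∀ᶠ w in 𝓝 w₀, φ.rightFun w ∈ V :=
    hright.continuous.continuousAt.eventually (hV.mem_nhds hV0)
  refine ⟨_, hnear.and hnearV, measure_mono_null ?_ hcrit⟩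
  rintro _ ⟨w, ⟨⟨hwN, hHw, -, hker⟩, hw, hwV⟩, rfl⟩
  have hγw : γ (φ.rightFun w) = w := by
    change φ.implicitFunction 0 _ = w
    rw [← hHw]; exact hw
  refine ⟨φ.rightFun w, ⟨hwV, ?_⟩, by simp only [hγw]⟩
  have hγd : HasFDerivAt γ (fderiv ℝ γ (φ.rightFun w)) (φ.rightFun w) :=
    ((hVsub hwV).2.2.differentiableAt (by norm_num)).hasFDerivAt
  have hHd : HasFDerivAt H (fderiv ℝ H w) (γ (φ.rightFun w)) := by
    rw [hγw]
    exact ((hH.contDiffAt (hN.mem_nhds hwN)).differentiableAt (by norm_num)).hasFDerivAt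
  have hzero : (fderiv ℝ H w).comp (fderiv ℝ γ (φ.rightFun w)) = 0 := by
    have h1 := hHd.comp _ hγd
    refine h1.unique ((hasFDerivAt_const (0 : Y) (φ.rightFun w)).congr_of_eventuallyEq ?_)
    filter_upwards [hV.mem_nhds hwV] with k hk using (hVsub hk).1
  have hlγ : HasFDerivAt (fun k ↦ l (γ k)) (l.comp (fderiv ℝ γ (φ.rightFun w))) _ :=
    l.hasFDerivAt.comp _ hγd
  rw [hlγ.fderiv]
  ext v
  exact hker _ (DFunLike.congr_fun hzero v)

variable {E : Type*} [NormedAddCommGroup E] [NormedSpace ℝ E] [FiniteDimensional ℝ E]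
  {F : (ℝ × ℝ) × E → Y} {N : Set ((ℝ × ℝ) × E)}

/-- The zeros of `F` in `N` at which `F` is not submersive in the second variable. -/
def singularZeros (F : (ℝ × ℝ) × E → Y) (N : Set ((ℝ × ℝ) × E)) : Set ((ℝ × ℝ) × E) :=
  {z ∈ N | F z = 0 ∧
    ¬ Function.Surjective ((fderiv ℝ F z).comp (ContinuousLinearMap.inr ℝ (ℝ × ℝ) E))}

/-- Over the line through `c` along `e` the zeros form a level surface. At a singular zero the line
parameter is critical on this surface: a tangent vector with nonzero parameter component would put
the derivative along `e` into the range of the partial derivative in `E`, making the latter onto. -/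
theorem volume_slice_singularZeros_eq_zero (hEY : finrank ℝ E = finrank ℝ Y + 1)
    (hN : IsOpen N) (hF : ContDiffOn ℝ 3 F N) (c e : ℝ × ℝ) :
    volume {s : ℝ | ∃ x, (c + s • e, x) ∈ singularZeros F N ∧
      Function.Surjective ((fderiv ℝ F (c + s • e, x)).comp (lineMap E e))} = 0 := by
  let A : ℝ × E → (ℝ × ℝ) × E := fun w ↦ (c, 0) + lineMap E e w
  have hA : ∀ w, A w = (c + w.1 • e, w.2) := fun w ↦ by simp [A, lineMap_apply]
  have hAc : ContDiff ℝ 3 A := by fun_prop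
  have hAd : ∀ w, HasFDerivAt A (lineMap E e) w := fun w ↦
    ((lineMap E e).hasFDerivAt).const_add (c, 0)
  have hd : ∀ w, A w ∈ N → fderiv ℝ (F ∘ A) w = (fderiv ℝ F (A w)).comp (lineMap E e) :=
    fun w hw ↦ (((hF.contDiffAt (hN.mem_nhds hw)).differentiableAt
      (by norm_num)).hasFDerivAt.comp w (hAd w)).fderiv
  have key := volume_image_level_critical_eq_zero (W := ℝ × E) (Y := Y)
    (by rw [finrank_prod, hEY]; simp; ring) (ContinuousLinearMap.fst ℝ ℝ E)
    (hN.preimage hAc.continuous) (hF.comp hAc.contDiffOn (mapsTo_preimage A N))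
  refine measure_mono_null ?_ key
  rintro s ⟨x, ⟨hzN, hz0, hns⟩, hs⟩
  refine ⟨(s, x), ⟨?_, ?_, ?_, ?_⟩, rfl⟩
  · simpa [hA] using hzN
  · simpa [hA] using hz0
  · rw [hd _ (by simpa [hA] using hzN), hA]
    exact hs
  · rintro ⟨σ, ξ⟩ hk
    rw [hd _ (by simpa [hA] using hzN), hA] at hk
    by_contra hσ
    refine hns fun y ↦ ?_
    obtain ⟨⟨τ, η⟩, hy⟩ := hs y
    -- Subtracting a multiple of the kernel vector removes the parameter component.
    refine ⟨η - (τ / σ) • ξ, ?_⟩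
    have h1 : ((0 : ℝ × ℝ), η - (τ / σ) • ξ) =
        lineMap E e (τ, η) - (τ / σ) • lineMap E e (σ, ξ) := by
      have hσ' : σ ≠ 0 := hσ
      simp [lineMap_apply, smul_smul, div_mul_cancel₀ _ hσ']
    simp only [ContinuousLinearMap.coe_comp, Function.comp_apply,
      ContinuousLinearMap.inr_apply] at hk hy ⊢
    rw [h1, map_sub, map_smul, hk, hy, smul_zero, sub_zero]

/-- Compactness supplies the measurability that Fubini needs for the projected set. -/
theorem exists_compact_nhds_singularZeros (hN : IsOpen N) (hF : ContDiffOn ℝ 3 F N)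
    (e : ℝ × ℝ) {z : (ℝ × ℝ) × E} (hz : z ∈ N)
    (hs : Function.Surjective ((fderiv ℝ F z).comp (lineMap E e))) :
    ∃ K ∈ 𝓝 z, IsCompact (Prod.fst '' (singularZeros F N ∩ K)) ∧
      ∀ w ∈ K, Function.Surjective ((fderiv ℝ F w).comp (lineMap E e)) := by
  have hfd : ContinuousOn (fderiv ℝ F) N := hF.continuousOn_fderiv_of_isOpen hN (by norm_num)
  have hO : IsOpen (N ∩ (fun w ↦ (fderiv ℝ F w).comp (lineMap E e)) ⁻¹'
      {A | Function.Surjective A}) :=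
    ContinuousOn.isOpen_inter_preimage (by fun_prop) hN
      ContinuousLinearMap.isOpen_setOf_surjective
  obtain ⟨K, hK, hzK, hKN⟩ := exists_compact_subset hO ⟨hz, hs⟩
  have hKN' : K ⊆ N := fun w hw ↦ (hKN hw).1
  refine ⟨K, mem_interior_iff_mem_nhds.1 hzK, IsCompact.image ?_ continuous_fst,
    fun w hw ↦ (hKN hw).2⟩
  have h1 : IsClosed (K ∩ F ⁻¹' {0}) :=
    (hF.continuousOn.mono hKN').preimage_isClosed_of_isClosed hK.isClosed isClosed_singleton
  have h2 : IsClosed (K ∩ (fun w ↦ (fderiv ℝ F w).comp (ContinuousLinearMap.inr ℝ (ℝ × ℝ) E)) ⁻¹'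
      {A | Function.Surjective A}ᶜ) :=
    ContinuousOn.preimage_isClosed_of_isClosed (by have := hfd.mono hKN'; fun_prop) hK.isClosed
      ContinuousLinearMap.isOpen_setOf_surjective.isClosed_compl
  convert hK.inter_left (h1.inter h2) using 1
  ext w
  constructor
  · rintro ⟨⟨-, h0, hn⟩, hwK⟩
    exact ⟨⟨⟨hwK, h0⟩, hwK, hn⟩, hwK⟩
  · rintro ⟨⟨⟨-, h0⟩, -, hn⟩, hwK⟩
    exact ⟨⟨hKN' hwK, h0, hn⟩, hwK⟩

/-- The parametric transversality theorem for two parameters and maps from a space of dimension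
three to a plane. -/
theorem volume_image_singularZeros_eq_zero (hE : finrank ℝ E = 3) (hY : finrank ℝ Y = 2)
    (hN : IsOpen N) (hF : ContDiffOn ℝ 3 F N)
    (hp : ∀ z ∈ N, Function.Surjective
      ((fderiv ℝ F z).comp (ContinuousLinearMap.inl ℝ (ℝ × ℝ) E))) :
    volume (Prod.fst '' singularZeros F N) = 0 := by
  borelize E
  set Z := singularZeros F N
  have hEY : finrank ℝ E = finrank ℝ Y + 1 := by rw [hE, hY]
  have hfd : ∀ z ∈ N, HasFDerivAt F (fderiv ℝ F z) z := fun z hz ↦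
    ((hF.contDiffAt (hN.mem_nhds hz)).differentiableAt (by norm_num)).hasFDerivAt
  have hF1 : ContDiffOn ℝ 1 (fderiv ℝ F) N := hF.fderiv_of_isOpen hN (by norm_num)
  let D (z : (ℝ × ℝ) × E) : E →L[ℝ] Y :=
    (fderiv ℝ F z).comp (ContinuousLinearMap.inr ℝ (ℝ × ℝ) E)
  -- If `D z` has rank one and neither axis makes the restricted derivative onto, both parameter
  -- derivatives lie in the range of `D z`; then `hp` would make `D z` onto.
  have hZ : Z = {z ∈ Z | D z = 0} ∪
      ({z ∈ Z | Function.Surjective ((fderiv ℝ F z).comp (lineMap E (0, 1)))} ∪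
        {z ∈ Z | Function.Surjective ((fderiv ℝ F z).comp (lineMap E (1, 0)))}) := by
    ext z
    simp only [mem_union, mem_ofPred_eq]
    refine ⟨fun hz ↦ ?_, by tauto⟩
    by_contra! hcon
    obtain ⟨h0, h1, h2⟩ := hcon
    have hD : D z ≠ 0 := h0 hz
    have hR : ¬ Function.Surjective (D z) := hz.2.2
    have hrank : 1 ≤ finrank ℝ (D z).range := by
      rw [Nat.one_le_iff_ne_zero, Ne, Submodule.finrank_eq_zero, LinearMap.range_eq_bot]
      exact fun h ↦ hD (ContinuousLinearMap.coe_injective h)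
    have hline : ∀ e, ¬ Function.Surjective ((fderiv ℝ F z).comp (lineMap E e)) →
        fderiv ℝ F z (e, 0) ∈ (D z).range := by
      intro e he
      set R := ((fderiv ℝ F z).comp (lineMap E e)).range
      have hle : (D z).range ≤ R := by
        rintro _ ⟨x, rfl⟩
        exact ⟨(0, x), by simp [D, lineMap_apply]⟩
      have hlt : finrank ℝ R < 2 := by
        rw [← hY]
        exact Submodule.finrank_lt fun h ↦ he (LinearMap.range_eq_top.1 h)
      rw [Submodule.eq_of_le_of_finrank_le hle (by omega)]
      exact ⟨(1, 0), by simp [lineMap_apply]⟩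
    have ha := hline _ (h2 hz)
    have hb := hline _ (h1 hz)
    refine hR fun y ↦ ?_
    obtain ⟨⟨a, b⟩, rfl⟩ := hp z hz.1 y
    have h3 : fderiv ℝ F z ((a, b), 0) =
        a • fderiv ℝ F z ((1, 0), 0) + b • fderiv ℝ F z ((0, 1), 0) := by
      rw [← map_smul, ← map_smul, ← map_add]
      simp
    simp only [ContinuousLinearMap.coe_comp, Function.comp_apply, ContinuousLinearMap.inl_apply]
    rw [h3]
    exact (D z).range.add_mem ((D z).range.smul_mem _ ha) ((D z).range.smul_mem _ hb)
  rw [hZ, image_union, image_union]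
  refine measure_union_null ?_ (measure_union_null ?_ ?_)
  · rw [← hausdorffMeasure_prod_real]
    refine measure_image_eq_zero_of_locally _ _ fun z₀ hz₀ ↦ ?_
    have hz₀N := hz₀.1.1
    obtain ⟨C, hC, r, hr, hrN, hl⟩ := hF1.exists_ball_norm_sub_le hN hz₀N
    set P := (fderiv ℝ F z₀).comp (ContinuousLinearMap.inl ℝ (ℝ × ℝ) E)
    have hPinj : P.toLinearMap.ker = ⊥ := LinearMap.ker_eq_bot.2
      ((LinearMap.injective_iff_surjective_of_finrank_eq_finrank (by simp [hY])).2 (hp z₀ hz₀N))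
    obtain ⟨K, hK0, hK⟩ := P.toLinearMap.exists_antilipschitzWith hPinj
    have hK' : ∀ p, ‖p‖ ≤ K * ‖P p‖ := fun p ↦ by simpa using hK.le_mul_dist p 0
    have hc0 : 0 < (2 * K)⁻¹ := by positivity
    obtain ⟨s, hs, hFs⟩ := ((hF.contDiffAt (hN.mem_nhds hz₀N)).hasStrictFDerivAt
      (by norm_num)).approximates_deriv_on_nhds (Or.inr hc0)
    obtain ⟨ρ, hρ, hρs⟩ := Metric.mem_nhds_iff.1 (inter_mem hs (Metric.ball_mem_nhds z₀ hr))
    have hρr : Metric.ball z₀ ρ ⊆ Metric.ball z₀ r := fun z hz ↦ (hρs hz).2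
    refine ⟨_, Metric.ball_mem_nhds z₀ hρ, ?_⟩
    -- The parameter depends on the point to order 2, and `E` has dimension 3 < 2 · 2.
    refine hausdorffMeasure_image_eq_zero_of_dist_le (a := Prod.snd) (C := 2 * K * C) (n := 2)
      (by simp) zero_le_two ?_ ?_
    · rintro ⟨p, x⟩ ⟨⟨⟨-, hz0, -⟩, hDz⟩, hz⟩ ⟨q, y⟩ ⟨⟨⟨-, hw0, -⟩, -⟩, hw⟩
      rw [dist_eq_norm, dist_eq_norm, ← neg_sub y x, norm_neg]
      obtain ⟨p₀, x₀⟩ := z₀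
      rw [← ball_prod_same] at hz hw hρr
      -- The mixed point links the two zeros: `F (p, y)` is quadratically small since `D` vanishes
      -- at `(p, x)`, and it bounds `p - q` since `F (q, y) = 0` and `P` is injective.
      have hpy : (p, y) ∈ Metric.ball p₀ ρ ×ˢ Metric.ball x₀ ρ := ⟨hz.1, hw.2⟩
      have h1 : ‖F (p, y) - F (p, x)‖ ≤ C * ‖y - x‖ ^ 2 := by
        refine norm_sub_le_pow_succ (f := fun y ↦ F (p, y)) (n := 1) (convex_ball x₀ ρ)
          (fun v hv ↦ ?_) hC hz.2 (fun v hv ↦ ?_) hw.2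
        · exact (hfd _ (hrN (hρr (mk_mem_prod hz.1 hv)))).differentiableAt.comp v (by fun_prop)
        · have h2 : fderiv ℝ (fun y ↦ F (p, y)) v = D (p, v) :=
            ((hfd _ (hrN (hρr (mk_mem_prod hz.1 hv)))).comp v (hasFDerivAt_prodMk_right p v)).fderiv
          rw [h2]
          have h3 : D (p, v) = (fderiv ℝ F (p, v) - fderiv ℝ F (p, x)).comp
              (ContinuousLinearMap.inr ℝ (ℝ × ℝ) E) := by
            rw [ContinuousLinearMap.sub_comp]
            change D (p, v) = D (p, v) - D (p, x)
            rw [hDz, sub_zero]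
          rw [h3]
          calc _ ≤ ‖fderiv ℝ F (p, v) - fderiv ℝ F (p, x)‖ *
                ‖ContinuousLinearMap.inr ℝ (ℝ × ℝ) E‖ := ContinuousLinearMap.opNorm_comp_le _ _
            _ ≤ (C * ‖(p, v) - (p, x)‖) * 1 := by
                gcongr
                · exact hl _ (hρr hz) _ (hρr (mk_mem_prod hz.1 hv))
                · exact ContinuousLinearMap.norm_inr_le_one ..
            _ = C * ‖v - x‖ ^ 1 := by simp [Prod.norm_def]
      rw [hz0, sub_zero] at h1
      have h4 := hFs (p, y) (hρs (by rw [← ball_prod_same]; exact hpy)).1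
        (q, y) (hρs (by rw [← ball_prod_same]; exact hw)).1
      have h5 : fderiv ℝ F (p₀, x₀) ((p, y) - (q, y)) = P (p - q) := by simp [P]
      rw [h5, hw0, sub_zero] at h4
      have h6 : ‖(p, y) - (q, y)‖ = ‖p - q‖ := by simp [Prod.norm_def]
      rw [h6] at h4
      have h7 : ‖P (p - q)‖ ≤ ((2 * K)⁻¹ : NNReal) * ‖p - q‖ + C * ‖y - x‖ ^ 2 := by
        calc ‖P (p - q)‖ = ‖F (p, y) - (F (p, y) - P (p - q))‖ := by congr 1; abel
          _ ≤ ‖F (p, y)‖ + ‖F (p, y) - P (p - q)‖ := norm_sub_le _ _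
          _ ≤ _ := by linarith
      have h8 : ‖p - q‖ ≤ K * (((2 * K)⁻¹ : NNReal) * ‖p - q‖ + C * ‖y - x‖ ^ 2) :=
        (hK' _).trans (by gcongr)
      have h9 : (K : ℝ) * (((2 * K)⁻¹ : NNReal) * ‖p - q‖) = ‖p - q‖ / 2 := by
        have : (K : ℝ) ≠ 0 := by exact_mod_cast hK0.ne'
        push_cast
        field_simp
      nlinarith
    · rw [Real.hausdorffMeasure_of_finrank_lt (by rw [hE]; norm_num)]
      simp
  · refine measure_image_eq_zero_of_locally _ _ fun z hz ↦ ?_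
    obtain ⟨K, hKz, hK, hKs⟩ := exists_compact_nhds_singularZeros hN hF _ hz.1.1 hz.2
    refine ⟨K, hKz, measure_mono_null (image_mono (inter_subset_inter_left _ (sep_subset _ _)))
      ((measure_prod_null hK.measurableSet).2 (Eventually.of_forall fun t ↦ ?_))⟩
    refine measure_mono_null ?_ (volume_slice_singularZeros_eq_zero hEY hN hF (t, 0) (0, 1))
    rintro s ⟨⟨p, x⟩, ⟨hzZ, hzK⟩, rfl⟩
    exact ⟨x, by simpa using hzZ, hKs _ (by simpa using hzK)⟩
  · refine measure_image_eq_zero_of_locally _ _ fun z hz ↦ ?_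
    obtain ⟨K, hKz, hK, hKs⟩ := exists_compact_nhds_singularZeros hN hF _ hz.1.1 hz.2
    refine ⟨K, hKz, measure_mono_null (image_mono (inter_subset_inter_left _ (sep_subset _ _))) ?_⟩
    -- The slices now run along the first axis, so Fubini is applied after swapping the factors.
    rw [Measure.volume_eq_prod, ← (measurePreserving_swap (μ := (volume : Measure ℝ))
      (ν := (volume : Measure ℝ))).measure_preimage hK.measurableSet.nullMeasurableSet]
    refine (measure_prod_null (hK.measurableSet.preimage measurable_swap)).2
      (Eventually.of_forall fun t ↦ ?_)
    refine measure_mono_null ?_ (volume_slice_singularZeros_eq_zero hEY hN hF (0, t) (1, 0))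
    rintro s ⟨⟨p, x⟩, ⟨hzZ, hzK⟩, hp⟩
    obtain rfl : p = (s, t) := hp
    exact ⟨x, by simpa using hzZ, hKs _ (by simpa using hzK)⟩

end Transversality

/-! ### The complex determinant and exponentials of skew operators -/

section ComplexDeterminant

open MeasureTheory Set Filter Topology Module

open scoped InnerProductSpace

/-- The complex determinant of three vectors of `ℂ³`. -/
def cdet (v : Fin 3 → C3) : ℂ :=
  Matrix.det (Matrix.of fun i j ↦ v i j)

theorem cdet_eq (v : Fin 3 → C3) : cdet v =
    v 0 0 * v 1 1 * v 2 2 - v 0 0 * v 1 2 * v 2 1 - v 0 1 * v 1 0 * v 2 2 +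
      v 0 1 * v 1 2 * v 2 0 + v 0 2 * v 1 0 * v 2 1 - v 0 2 * v 1 1 * v 2 0 := by
  simp [cdet, Matrix.det_fin_three]

theorem cdet_eq_zero_iff_not_linearIndependent (v : Fin 3 → C3) :
    cdet v = 0 ↔ ¬ LinearIndependent ℂ v := by
  rw [Fintype.not_linearIndependent_iff, cdet, ← Matrix.exists_vecMul_eq_zero_iff]
  refine exists_congr fun c ↦ ?_
  rw [and_comm, Function.ne_iff]
  refine and_congr ?_ Iff.rfl
  rw [PiLp.ext_iff, funext_iff]
  refine forall_congr' fun j ↦ ?_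
  simp [Matrix.vecMul, dotProduct]

theorem cdet_sum_smul (P : Matrix (Fin 3) (Fin 3) ℝ) (b : Fin 3 → C3) :
    cdet (fun i ↦ ∑ k, P i k • b k) = P.det * cdet b := by
  have : (Matrix.of fun i j ↦ (∑ k, P i k • b k) j : Matrix (Fin 3) (Fin 3) ℂ) =
      (P.map Complex.ofRealHom) * Matrix.of fun i j ↦ b i j := by
    ext i j
    simp [Matrix.mul_apply]
  rw [cdet, this, Matrix.det_mul, ← RingHom.mapMatrix_apply, ← RingHom.map_det]
  rfl

/-- A real frame is complex dependent exactly if its span contains a complex line. -/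
theorem cdet_eq_zero_iff {v : Fin 3 → C3} (hv : LinearIndependent ℝ v) :
    cdet v = 0 ↔ Submodule.span ℝ (range v) ⊓ (Submodule.span ℝ (range v)).map mulI ≠ ⊥ := by
  rw [cdet_eq_zero_iff_not_linearIndependent, Fintype.not_linearIndependent_iff,
    Submodule.ne_bot_iff]
  rw [Fintype.linearIndependent_iff] at hv
  have key : ∀ a b : Fin 3 → ℝ, ∑ i, (a i + b i * Complex.I : ℂ) • v i =
      ∑ i, a i • v i + Complex.I • ∑ i, b i • v i := by
    intro a b
    rw [Finset.smul_sum, ← Finset.sum_add_distrib]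
    refine Finset.sum_congr rfl fun i _ ↦ ?_
    rw [add_smul, mul_comm, mul_smul, Complex.coe_smul, Complex.coe_smul]
  constructor
  -- Splitting a complex relation into real and imaginary parts exhibits one vector as an element of
  -- both `T` and `J T`.
  · rintro ⟨c, hc, i, hi⟩
    have hc' : ∑ i, (c i).re • v i + Complex.I • ∑ i, (c i).im • v i = 0 := by
      rw [← key, ← hc]
      simp
    refine ⟨∑ i, (c i).re • v i, ⟨?_, ?_⟩, fun h0 ↦ hi ?_⟩
    · exact Submodule.sum_mem _ fun i _ ↦ Submodule.smul_mem _ _ (Submodule.subset_span ⟨i, rfl⟩)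
    · refine ⟨-∑ i, (c i).im • v i, Submodule.neg_mem _ (Submodule.sum_mem _ fun i _ ↦
        Submodule.smul_mem _ _ (Submodule.subset_span ⟨i, rfl⟩)), ?_⟩
      change Complex.I • (-∑ i, (c i).im • v i) = _
      rw [smul_neg]
      exact (eq_neg_of_add_eq_zero_left hc').symm
    · have h1 := hv _ h0 i
      rw [h0, zero_add, smul_eq_zero, or_iff_right Complex.I_ne_zero] at hc'
      exact Complex.ext h1 (hv _ hc' i)
  · rintro ⟨x, ⟨hx, y, hy, hyx⟩, hx0⟩
    obtain ⟨a, rfl⟩ := (Submodule.mem_span_range_iff_exists_fun ℝ).1 hx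
    obtain ⟨b, rfl⟩ := (Submodule.mem_span_range_iff_exists_fun ℝ).1 hy
    refine ⟨fun i ↦ a i + ((-b i : ℝ) : ℂ) * Complex.I, ?_, ?_⟩
    · rw [key a (fun i ↦ -b i)]
      simp only [neg_smul, Finset.sum_neg_distrib, smul_neg]
      rw [add_neg_eq_zero]
      exact hyx.symm
    · by_contra! hcon
      refine hx0 (Finset.sum_eq_zero fun i _ ↦ ?_)
      have := congrArg Complex.re (hcon i)
      simp at this
      simp [this]

/-- The skew-symmetric operator of rank two attached to two vectors. -/
noncomputable def skewOp (u m : C3) : C3 →L[ℝ] C3 :=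
  (innerSL ℝ u).smulRight m - (innerSL ℝ m).smulRight u

theorem skewOp_apply (u m x : C3) : skewOp u m x = ⟪u, x⟫_ℝ • m - ⟪m, x⟫_ℝ • u := rfl

/-- The complex line of skew-symmetric operators attached to two vectors. -/
noncomputable def rotGen (u n : C3) : ℝ × ℝ →L[ℝ] C3 →L[ℝ] C3 :=
  LinearMap.toContinuousLinearMap
    { toFun := fun p ↦ skewOp u ((p.1 + p.2 * Complex.I : ℂ) • n)
      map_add' := fun p q ↦ by
        ext1 x
        have : ((p + q).1 + (p + q).2 * Complex.I : ℂ) =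
            (p.1 + p.2 * Complex.I) + (q.1 + q.2 * Complex.I) := by
          push_cast [Prod.fst_add, Prod.snd_add]; ring
        rw [this, add_smul]
        change _ = skewOp u _ x + skewOp u _ x
        rw [skewOp_apply, skewOp_apply, skewOp_apply, smul_add, inner_add_left]
        module
      map_smul' := fun r p ↦ by
        ext1 x
        have : ((r • p).1 + (r • p).2 * Complex.I : ℂ) = (r : ℂ) * (p.1 + p.2 * Complex.I) := by
          simp; ring
        rw [this, mul_smul, Complex.coe_smul]
        change _ = r • skewOp u _ x
        rw [skewOp_apply, skewOp_apply, real_inner_smul_left]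
        module }

theorem rotGen_apply (u n : C3) (p : ℝ × ℝ) :
    rotGen u n p = skewOp u ((p.1 + p.2 * Complex.I : ℂ) • n) := rfl

/-- The rotations of `ℂ³`, as a set of operators. -/
def rotations : Set (C3 →L[ℝ] C3) :=
  {A | (∀ x, ‖A x‖ = ‖x‖) ∧ LinearMap.det (A : C3 →ₗ[ℝ] C3) = 1}

theorem one_mem_rotations : (1 : C3 →L[ℝ] C3) ∈ rotations :=
  ⟨fun _ ↦ rfl, LinearMap.det_id⟩

theorem mul_mem_rotations {A B : C3 →L[ℝ] C3} (hA : A ∈ rotations) (hB : B ∈ rotations) :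
    A * B ∈ rotations := by
  refine ⟨fun x ↦ (hA.1 _).trans (hB.1 x), ?_⟩
  have : ((A * B : C3 →L[ℝ] C3) : C3 →ₗ[ℝ] C3) = (A : C3 →ₗ[ℝ] C3) * (B : C3 →ₗ[ℝ] C3) := rfl
  rw [this, map_mul, hA.2, hB.2, one_mul]

theorem isClosed_rotations : IsClosed rotations := by
  have h1 : rotations = (⋂ x, {A : C3 →L[ℝ] C3 | ‖A x‖ = ‖x‖}) ∩
      {A : C3 →L[ℝ] C3 | A.det = 1} := by
    ext A; simp [rotations]
  rw [h1]
  refine (isClosed_iInter fun x ↦ isClosed_eq (by fun_prop) (by fun_prop)).inter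
    (isClosed_eq ContinuousLinearMap.continuous_det continuous_const)

theorem abs_det_of_norm_map (A : C3 →L[ℝ] C3) (hA : ∀ x, ‖A x‖ = ‖x‖) :
    |LinearMap.det (A : C3 →ₗ[ℝ] C3)| = 1 := by
  have h := LinearIsometry.normDet_eq_one (𝕜 := ℝ) (⟨A.toLinearMap, hA⟩ : C3 →ₗᵢ[ℝ] C3)
  rw [LinearMap.normDet_eq_abs_det] at h
  exact h

theorem skewOp_mem_skewAdjoint (u m : C3) : skewOp u m ∈ skewAdjoint (C3 →L[ℝ] C3) := by
  rw [skewAdjoint.mem_iff, ContinuousLinearMap.star_eq_adjoint, eq_comm,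
    ContinuousLinearMap.eq_adjoint_iff]
  intro x y
  rw [neg_apply, inner_neg_left, skewOp_apply, skewOp_apply, inner_sub_left, inner_sub_right,
    real_inner_smul_left, real_inner_smul_left, real_inner_smul_right, real_inner_smul_right,
    real_inner_comm x u, real_inner_comm x m]
  ring

theorem norm_exp_skewOp_apply (u m x : C3) : ‖NormedSpace.exp (skewOp u m) x‖ = ‖x‖ := by
  let := NormedAlgebra.restrictScalars ℚ ℝ (C3 →L[ℝ] C3)
  have h : NormedSpace.exp (skewOp u m) ∈ unitary (C3 →L[ℝ] C3) :=
    NormedSpace.exp_mem_unitary_of_mem_skewAdjoint (skewOp_mem_skewAdjoint u m)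
  exact ContinuousLinearMap.norm_map_of_mem_unitary h x

/-- The exponential is the square of the exponential of half the operator, an isometry of
determinant ±1, so its own determinant is 1. -/
theorem exp_skewOp_mem_rotations (u m : C3) : NormedSpace.exp (skewOp u m) ∈ rotations := by
  refine ⟨norm_exp_skewOp_apply u m, ?_⟩
  have hhalf : skewOp u m = skewOp u ((2 : ℝ)⁻¹ • m) + skewOp u ((2 : ℝ)⁻¹ • m) := by
    ext1 x
    rw [add_apply, skewOp_apply, skewOp_apply, real_inner_smul_left]
    module
  let := NormedAlgebra.restrictScalars ℚ ℝ (C3 →L[ℝ] C3)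
  rw [hhalf, NormedSpace.exp_add_of_commute (Commute.refl _)]
  set B := NormedSpace.exp (skewOp u ((2 : ℝ)⁻¹ • m)) with hB
  have h1 : ((B * B : C3 →L[ℝ] C3) : C3 →ₗ[ℝ] C3) = (B : C3 →ₗ[ℝ] C3) * (B : C3 →ₗ[ℝ] C3) := rfl
  have h2 : |LinearMap.det (B : C3 →ₗ[ℝ] C3)| = 1 :=
    abs_det_of_norm_map B (norm_exp_skewOp_apply u _)
  rw [h1, map_mul, ← abs_mul_abs_self, h2, one_mul]

theorem contDiff_exp_rotGen (u n : C3) :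
    ContDiff ℝ ∞ fun p ↦ NormedSpace.exp (rotGen u n p) := by
  have h1 : ContDiff ℝ ∞ (NormedSpace.exp : (C3 →L[ℝ] C3) → (C3 →L[ℝ] C3)) :=
    contDiff_iff_contDiffAt.2 fun A ↦ (NormedSpace.exp_analytic (𝕂 := ℝ) A).contDiffAt
  exact h1.comp (rotGen u n).contDiff

theorem hasFDerivAt_exp_rotGen (u n : C3) :
    HasFDerivAt (fun p ↦ NormedSpace.exp (rotGen u n p)) (rotGen u n) 0 := by
  have h1 : HasFDerivAt (NormedSpace.exp : (C3 →L[ℝ] C3) → (C3 →L[ℝ] C3))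
      (1 : (C3 →L[ℝ] C3) →L[ℝ] (C3 →L[ℝ] C3)) (rotGen u n 0) := by
    rw [map_zero]
    exact hasStrictFDerivAt_exp_zero.hasFDerivAt
  exact h1.comp 0 (rotGen u n).hasFDerivAt

theorem contDiff_cdet : ContDiff ℝ ∞ cdet := by
  have h : ∀ i j, ContDiff ℝ ∞ fun v : Fin 3 → C3 ↦ v i j := fun i j ↦
    (((EuclideanSpace.proj j : C3 →L[ℂ] ℂ).restrictScalars ℝ).comp
      (ContinuousLinearMap.proj (R := ℝ) (φ := fun _ : Fin 3 ↦ C3) i)).contDiff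
  simp only [funext cdet_eq]
  have := h 0 0; have := h 0 1; have := h 0 2
  have := h 1 0; have := h 1 1; have := h 1 2
  have := h 2 0; have := h 2 1; have := h 2 2
  fun_prop

end ComplexDeterminant

/-! ### Rotations move the determinant in every direction -/

section RotationFamily

open MeasureTheory Set Filter Topology Module
open scoped InnerProductSpace

/-- A three-dimensional real subspace that contains a complex line has an adapted frame. -/
theorem exists_adapted_frame {v : Fin 3 → C3} (hv : LinearIndependent ℝ v) (h0 : cdet v = 0) :
    ∃ (u w n : C3) (P : Matrix (Fin 3) (Fin 3) ℝ), u ≠ 0 ∧ cdet ![u, w, n] ≠ 0 ∧ P.det ≠ 0 ∧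
      v = fun i ↦ ∑ k, P i k • (![u, Complex.I • u, w] : Fin 3 → C3) k := by
  set T := Submodule.span ℝ (range v)
  obtain ⟨x, ⟨hx, u, hu, hux⟩, hx0⟩ := (Submodule.ne_bot_iff _).1 ((cdet_eq_zero_iff hv).1 h0)
  have hux' : Complex.I • u = x := hux
  have hu0 : u ≠ 0 := by
    rintro rfl
    exact hx0 (by rw [← hux', smul_zero])
  have hcomb : ∀ s t : ℝ, s • u + t • Complex.I • u = ((s + t * Complex.I : ℂ)) • u := fun s t ↦ by
    rw [add_smul, mul_smul, Complex.coe_smul, Complex.coe_smul]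
  have hT : finrank ℝ T = 3 := by rw [finrank_span_eq_card hv]; simp
  have h2 : LinearIndependent ℝ ![(⟨u, hu⟩ : T), ⟨x, hx⟩] := by
    rw [LinearIndependent.pair_iff]
    intro s t hst
    have h1 : s • u + t • x = 0 := congrArg Subtype.val hst
    rw [← hux', hcomb, smul_eq_zero, or_iff_left hu0] at h1
    exact ⟨by simpa using congrArg Complex.re h1, by simpa using congrArg Complex.im h1⟩
  obtain ⟨⟨w, hw⟩, hb⟩ := exists_linearIndependent_snoc_of_lt_finrank h2 (by rw [hT]; norm_num)
  set b : Fin 3 → T := Fin.snoc ![(⟨u, hu⟩ : T), ⟨x, hx⟩] ⟨w, hw⟩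
  replace hb : LinearIndependent ℝ b := hb
  have hbv : ∀ k, (b k : C3) = (![u, Complex.I • u, w] : Fin 3 → C3) k := by
    intro k
    fin_cases k
    · rfl
    · exact hux'.symm
    · rfl
  have hspan := hb.span_eq_top_of_card_eq_finrank (by rw [hT]; simp)
  have hP : ∀ i, ∃ c : Fin 3 → ℝ, ∑ k, c k • b k = ⟨v i, Submodule.subset_span ⟨i, rfl⟩⟩ :=
    fun i ↦ (Submodule.mem_span_range_iff_exists_fun ℝ).1 (by rw [hspan]; trivial)
  choose P hP using hP
  have hvP : v = fun i ↦ ∑ k, P i k • (![u, Complex.I • u, w] : Fin 3 → C3) k := by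
    funext i
    have := congrArg Subtype.val (hP i)
    simp only [Submodule.coe_sum, Submodule.coe_smul, hbv] at this
    exact this.symm
  have huw : LinearIndependent ℂ ![u, w] := by
    rw [LinearIndependent.pair_iff]
    intro s t hst
    -- Otherwise `w` would be a complex multiple of `u`, that is, a real combination of `u` and `i
    -- u`.
    have ht : t = 0 := by
      by_contra ht
      have h1 : w + (s / t) • u = 0 := by
        have : t⁻¹ • (s • u + t • w) = 0 := by rw [hst, smul_zero]
        rw [smul_add, smul_smul, smul_smul, inv_mul_cancel₀ ht, one_smul] at this
        rw [div_eq_inv_mul, add_comm]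
        exact this
      have h3 := Fintype.linearIndependent_iff.1 hb ![(s / t).re, (s / t).im, 1] (by
        ext1
        have := hcomb (s / t).re (s / t).im
        rw [Complex.re_add_im] at this
        simp only [Fin.sum_univ_three]
        change (s / t).re • u + (s / t).im • x + (1 : ℝ) • w = 0
        rw [← hux', this, one_smul, add_comm, h1]) 2
      simp at h3
    subst ht
    rw [zero_smul, add_zero, smul_eq_zero, or_iff_left hu0] at hst
    exact ⟨hst, rfl⟩
  obtain ⟨n, hn⟩ := exists_linearIndependent_snoc_of_lt_finrank huw (by simp)
  refine ⟨u, w, n, P, hu0, ?_, ?_, hvP⟩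
  · rw [Ne, cdet_eq_zero_iff_not_linearIndependent, not_not]
    have : (Fin.snoc ![u, w] n : Fin 3 → C3) = ![u, w, n] := by
      funext k
      fin_cases k <;> rfl
    rw [← this]
    exact hn
  · intro hdet
    obtain ⟨c, hc, hcP⟩ := Matrix.exists_vecMul_eq_zero_iff.2 hdet
    refine hc (funext fun i ↦ Fintype.linearIndependent_iff.1 hv c ?_ i)
    rw [hvP]
    simp only [Finset.smul_sum, smul_smul]
    rw [Finset.sum_comm]
    simp only [← Finset.sum_smul]
    refine Finset.sum_eq_zero fun k _ ↦ ?_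
    have : ∑ i, c i * P i k = 0 := congrFun hcP k
    rw [this, zero_smul]

theorem cdet_map (A : C3 →L[ℝ] C3) (P : Matrix (Fin 3) (Fin 3) ℝ) (b : Fin 3 → C3) :
    cdet (fun i ↦ A (∑ k, P i k • b k)) = P.det * cdet (fun k ↦ A (b k)) := by
  rw [← cdet_sum_smul]
  simp

theorem contDiff_cdet_apply :
    ContDiff ℝ ∞ fun q : (C3 →L[ℝ] C3) × (Fin 3 → C3) ↦ cdet fun i ↦ q.1 (q.2 i) := by
  refine contDiff_cdet.comp (contDiff_pi.2 fun i ↦ ?_)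
  fun_prop

/-- Differentiate one column at a time. Moving `w` contributes nothing, as `u` and `i u` are complex
dependent; moving `i u` contributes nothing, as it is orthogonal to `u` and the generator sends it
to a multiple of `u`. Moving `u` leaves the term in `n`. -/
theorem hasDerivAt_cdet_exp (u w n : C3) (p : ℝ × ℝ) :
    HasDerivAt (fun t : ℝ ↦ cdet fun i ↦
        NormedSpace.exp (rotGen u n (t • p)) ((![u, Complex.I • u, w] : Fin 3 → C3) i))
      ((‖u‖ ^ 2 : ℝ) * (p.1 + p.2 * Complex.I) * Complex.I * cdet ![u, w, n]) 0 := by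
  set b : Fin 3 → C3 := ![u, Complex.I • u, w] with hb
  have h : ∀ i j, HasDerivAt (fun t : ℝ ↦ NormedSpace.exp (rotGen u n (t • p)) (b i) j)
      (rotGen u n p (b i) j) 0 := by
    intro i j
    have h1 : HasDerivAt (fun t : ℝ ↦ t • p) p 0 := by
      simpa using (hasDerivAt_id (0 : ℝ)).smul_const p
    have h2 : HasDerivAt (fun t : ℝ ↦ NormedSpace.exp (rotGen u n (t • p))) (rotGen u n p) 0 := by
      have h3 := hasFDerivAt_exp_rotGen u n
      rw [show (0 : ℝ × ℝ) = (0 : ℝ) • p by simp] at h3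
      exact h3.comp_hasDerivAt (0 : ℝ) h1
    have h4 : HasDerivAt (fun t : ℝ ↦ NormedSpace.exp (rotGen u n (t • p)) (b i))
        (rotGen u n p (b i)) 0 :=
      (ContinuousLinearMap.apply ℝ C3 (b i)).hasFDerivAt.comp_hasDerivAt (0 : ℝ) h2
    exact ((EuclideanSpace.proj j : C3 →L[ℂ] ℂ).restrictScalars
      ℝ).hasFDerivAt.comp_hasDerivAt (0 : ℝ) h4
  have key := (((((((h 0 0).mul (h 1 1)).mul (h 2 2)).sub (((h 0 0).mul (h 1 2)).mul (h 2 1))).sub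
    (((h 0 1).mul (h 1 0)).mul (h 2 2))).add (((h 0 1).mul (h 1 2)).mul (h 2 0))).add
    (((h 0 2).mul (h 1 0)).mul (h 2 1))).sub (((h 0 2).mul (h 1 1)).mul (h 2 0))
  simp only [funext fun t : ℝ ↦ cdet_eq fun i ↦ NormedSpace.exp (rotGen u n (t • p)) (b i)]
  refine key.congr_deriv ?_
  have he : NormedSpace.exp (rotGen u n ((0 : ℝ) • p)) = 1 := by
    rw [zero_smul, map_zero, NormedSpace.exp_zero]
  have hx : ∀ x, (1 : C3 →L[ℝ] C3) x = x := fun _ ↦ rfl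
  set c : ℂ := p.1 + p.2 * Complex.I with hc
  have hu1 : rotGen u n p (b 0) = (‖u‖ ^ 2 : ℝ) • c • n - ⟪c • n, u⟫_ℝ • u := by
    rw [rotGen_apply, skewOp_apply]
    simp only [hb, Matrix.cons_val_zero]
    rw [real_inner_self_eq_norm_sq]
  have hu2 : rotGen u n p (b 1) = -(⟪c • n, Complex.I • u⟫_ℝ • u) := by
    rw [rotGen_apply, skewOp_apply]
    have : ⟪u, Complex.I • u⟫_ℝ = 0 := by
      rw [PiLp.inner_apply]
      refine Finset.sum_eq_zero fun j _ ↦ ?_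
      simp [Complex.inner]
      ring
    simp [hb, this, ← hc]
  simp only [Pi.mul_apply, he, hx, hu1, hu2]
  generalize rotGen u n p (b 2) = z
  simp [hb, cdet_eq]
  ring

/-- In an adapted frame the derivative is multiplication by a nonzero complex number, once the
parameter plane is read as ℂ. -/
theorem surjective_fderiv_cdet_exp {v : Fin 3 → C3} (hv : LinearIndependent ℝ v)
    (h0 : cdet v = 0) : ∃ u n : C3, Function.Surjective
      (fderiv ℝ (fun p : ℝ × ℝ ↦ cdet fun i ↦ NormedSpace.exp (rotGen u n p) (v i)) 0) := by
  obtain ⟨u, w, n, P, hu, hd, hP, rfl⟩ := exists_adapted_frame hv h0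
  refine ⟨u, n, fun y ↦ ?_⟩
  set Φ : ℝ × ℝ → ℂ := fun p ↦ cdet fun i ↦ NormedSpace.exp (rotGen u n p)
    (∑ k, P i k • (![u, Complex.I • u, w] : Fin 3 → C3) k) with hΦ
  have hder : ∀ p : ℝ × ℝ, fderiv ℝ Φ 0 p = P.det *
      ((‖u‖ ^ 2 : ℝ) * (p.1 + p.2 * Complex.I) * Complex.I * cdet ![u, w, n]) := by
    intro p
    have hdiff : DifferentiableAt ℝ Φ 0 :=
      ((contDiff_cdet_apply.comp ((contDiff_exp_rotGen u n).prodMk contDiff_const)).differentiable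
        (by simp)).differentiableAt
    have h1 : HasDerivAt (fun t : ℝ ↦ t • p) p 0 := by
      simpa using (hasDerivAt_id (0 : ℝ)).smul_const p
    have h2 : HasDerivAt (fun t : ℝ ↦ Φ (t • p)) (fderiv ℝ Φ 0 p) 0 := by
      have h3 := hdiff.hasFDerivAt
      rw [show (0 : ℝ × ℝ) = (0 : ℝ) • p by simp] at h3
      have h4 := h3.comp_hasDerivAt (0 : ℝ) h1
      rw [zero_smul] at h4
      exact h4
    refine h2.unique ?_
    have h4 := (hasDerivAt_cdet_exp u w n p).const_mul (P.det : ℂ)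
    refine h4.congr_of_eventuallyEq (Eventually.of_forall fun t ↦ ?_)
    exact cdet_map _ _ _
  set κ : ℂ := P.det * ((‖u‖ ^ 2 : ℝ) * Complex.I * cdet ![u, w, n])
  have hκ : κ ≠ 0 := by
    have : ((‖u‖ ^ 2 : ℝ) : ℂ) ≠ 0 := by
      rw [Complex.ofReal_ne_zero]
      exact pow_ne_zero _ (norm_ne_zero_iff.2 hu)
    exact mul_ne_zero (Complex.ofReal_ne_zero.2 hP) (mul_ne_zero (mul_ne_zero this Complex.I_ne_zero) hd)
  refine ⟨((y / κ).re, (y / κ).im), ?_⟩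
  rw [hder]
  simp only [Complex.re_add_im]
  calc _ = κ * (y / κ) := by ring
    _ = y := mul_div_cancel₀ y hκ

end RotationFamily

/-! ### Generic rotations, by Baire category -/

section GenericRotation

open MeasureTheory Set Filter Topology Module

theorem fderiv_comp_prodMk_right {X Y Z : Type*} [NormedAddCommGroup X] [NormedSpace ℝ X]
    [NormedAddCommGroup Y] [NormedSpace ℝ Y] [NormedAddCommGroup Z] [NormedSpace ℝ Z]
    {f : X × Y → Z} {x : X} {y : Y} (hf : DifferentiableAt ℝ f (x, y)) :
    fderiv ℝ (fun y ↦ f (x, y)) y =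
      (fderiv ℝ f (x, y)).comp (ContinuousLinearMap.inr ℝ X Y) :=
  (hf.hasFDerivAt.comp y (hasFDerivAt_prodMk_right x y)).fderiv

theorem fderiv_comp_prodMk_left {X Y Z : Type*} [NormedAddCommGroup X] [NormedSpace ℝ X]
    [NormedAddCommGroup Y] [NormedSpace ℝ Y] [NormedAddCommGroup Z] [NormedSpace ℝ Z]
    {f : X × Y → Z} {x : X} {y : Y} (hf : DifferentiableAt ℝ f (x, y)) :
    fderiv ℝ (fun x ↦ f (x, y)) x =
      (fderiv ℝ f (x, y)).comp (ContinuousLinearMap.inl ℝ X Y) :=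
  (hf.hasFDerivAt.comp x (hasFDerivAt_prodMk_left x y)).fderiv

theorem exp_rotGen_mul_mem_rotations (u n : C3) (p : ℝ × ℝ) {A : C3 →L[ℝ] C3}
    (hA : A ∈ rotations) : NormedSpace.exp (rotGen u n p) * A ∈ rotations :=
  mul_mem_rotations (exp_skewOp_mem_rotations u _) hA

/-- The two-parameter family of rotations through `A` generated by `u` and `n`. -/
noncomputable def rotationFamily (u n : C3) (A : rotations) (p : ℝ × ℝ) : rotations :=
  ⟨NormedSpace.exp (rotGen u n p) * A.1, exp_rotGen_mul_mem_rotations u n p A.2⟩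

theorem continuous_rotationFamily (u n : C3) (A : rotations) :
    Continuous (rotationFamily u n A) := by
  have h : Continuous fun p ↦ NormedSpace.exp (rotGen u n p) := (contDiff_exp_rotGen u n).continuous
  exact (h.mul continuous_const).subtype_mk _

theorem rotationFamily_zero (u n : C3) (A : rotations) : rotationFamily u n A 0 = A := by
  apply Subtype.ext
  simp [rotationFamily]

variable {E : Type*} [NormedAddCommGroup E] [NormedSpace ℝ E]

/-- The pairs of an operator and a point of `U` at which the determinant of the rotated frame
vanishes without being submersive. -/
def degeneratePairs (v : E → Fin 3 → C3) (U : Set E) : Set ((C3 →L[ℝ] C3) × E) :=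
  {z | z.2 ∈ U ∧ cdet (fun i ↦ z.1 (v z.2 i)) = 0 ∧
    ¬ Function.Surjective (fderiv ℝ (fun y ↦ cdet fun i ↦ z.1 (v y i)) z.2)}

variable {v : E → Fin 3 → C3} {U : Set E}

theorem contDiffOn_cdet_frame (hv : ContDiffOn ℝ ∞ v U) :
    ContDiffOn ℝ ∞ (fun z : (C3 →L[ℝ] C3) × E ↦ cdet fun i ↦ z.1 (v z.2 i)) (univ ×ˢ U) := by
  have h1 : ContDiffOn ℝ ∞ (fun z : (C3 →L[ℝ] C3) × E ↦ v z.2) (univ ×ˢ U) :=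
    hv.comp contDiffOn_snd fun z hz ↦ hz.2
  have h2 : ContDiffOn ℝ ∞ (fun z : (C3 →L[ℝ] C3) × E ↦ (z.1, v z.2)) (univ ×ˢ U) :=
    contDiffOn_fst.prodMk h1
  simpa only [Function.comp_def] using contDiff_cdet_apply.comp_contDiffOn h2

/-- Both vanishing and failure of surjectivity are closed conditions. With `C` compact, the
projection to rotations is closed, so nowhere density reduces to empty interior. -/
theorem isClosed_degeneratePairs_inter (hU : IsOpen U) (hv : ContDiffOn ℝ ∞ v U)
    {C : Set ((C3 →L[ℝ] C3) × E)} (hC : IsClosed C) (hCU : ∀ z ∈ C, z.2 ∈ U) :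
    IsClosed (C ∩ degeneratePairs v U) := by
  have hΨ := contDiffOn_cdet_frame hv
  have hopen : IsOpen (univ ×ˢ U : Set ((C3 →L[ℝ] C3) × E)) := isOpen_univ.prod hU
  set Ψ : (C3 →L[ℝ] C3) × E → ℂ := fun z ↦ cdet fun i ↦ z.1 (v z.2 i)
  have hCU' : C ⊆ univ ×ˢ U := fun z hz ↦ ⟨trivial, hCU z hz⟩
  have hfd : ContinuousOn (fderiv ℝ Ψ) C :=
    (hΨ.continuousOn_fderiv_of_isOpen hopen (by simp)).mono hCU'
  have h1 : IsClosed (C ∩ Ψ ⁻¹' {0}) :=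
    (hΨ.continuousOn.mono hCU').preimage_isClosed_of_isClosed hC isClosed_singleton
  have h2 : IsClosed (C ∩ (fun z ↦ (fderiv ℝ Ψ z).comp
      (ContinuousLinearMap.inr ℝ (C3 →L[ℝ] C3) E)) ⁻¹' {A | Function.Surjective A}ᶜ) :=
    ContinuousOn.preimage_isClosed_of_isClosed (by fun_prop) hC
      ContinuousLinearMap.isOpen_setOf_surjective.isClosed_compl
  convert h1.inter h2 using 1
  ext ⟨A, y⟩
  have hd : (A, y) ∈ C → fderiv ℝ (fun y ↦ cdet fun i ↦ A (v y i)) y =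
      (fderiv ℝ Ψ (A, y)).comp (ContinuousLinearMap.inr ℝ (C3 →L[ℝ] C3) E) := fun h ↦
    fderiv_comp_prodMk_right (f := Ψ)
      ((hΨ.contDiffAt (hopen.mem_nhds (hCU' h))).differentiableAt (by simp))
  constructor
  · rintro ⟨hz, -, h0, hn⟩
    refine ⟨⟨hz, h0⟩, hz, ?_⟩
    change ¬ Function.Surjective ((fderiv ℝ Ψ (A, y)).comp
      (ContinuousLinearMap.inr ℝ (C3 →L[ℝ] C3) E))
    rw [← hd hz]
    exact hn
  · rintro ⟨⟨hz, h0⟩, -, hn⟩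
    refine ⟨hz, hCU _ hz, h0, ?_⟩
    simp only
    rw [hd hz]
    exact hn

variable [FiniteDimensional ℝ E]

/-- Near a zero of the determinant, the rotations that have a degenerate zero are nowhere
dense. -/
theorem exists_nhds_isNowhereDense_degenerate (hE : finrank ℝ E = 3) (hU : IsOpen U)
    (hv : ContDiffOn ℝ ∞ v U) (hind : ∀ y ∈ U, LinearIndependent ℝ (v y))
    {A₀ : rotations} {y₀ : E} (hy₀ : y₀ ∈ U) (h0 : cdet (fun i ↦ A₀.1 (v y₀ i)) = 0) :
    ∃ t ∈ 𝓝 (A₀, y₀), IsNowhereDense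
      {A : rotations | ∃ y, (A, y) ∈ t ∧ (A.1, y) ∈ degeneratePairs v U} := by
  have hind' : LinearIndependent ℝ fun i ↦ A₀.1 (v y₀ i) := by
    refine (hind y₀ hy₀).map' A₀.1.toLinearMap (LinearMap.ker_eq_bot'.2 fun x hx ↦ ?_)
    rw [← norm_eq_zero, ← A₀.2.1 x]
    exact norm_eq_zero.2 hx
  obtain ⟨u, n, hun⟩ := surjective_fderiv_cdet_exp hind' h0
  -- The base operator is a variable, so that the generators `u`, `n` chosen at `A₀` remain
  -- submersive at all nearby operators and points.
  let Ω : (ℝ × ℝ) × ((C3 →L[ℝ] C3) × E) → ℂ := fun q ↦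
    cdet fun i ↦ (NormedSpace.exp (rotGen u n q.1) * q.2.1) (v q.2.2 i)
  let N' : Set ((ℝ × ℝ) × ((C3 →L[ℝ] C3) × E)) := {q | q.2.2 ∈ U}
  have hN' : IsOpen N' := hU.preimage (by fun_prop)
  have hΩ : ContDiffOn ℝ ∞ Ω N' := by
    have h1 : ContDiff ℝ ∞ fun q : (ℝ × ℝ) × ((C3 →L[ℝ] C3) × E) ↦
        NormedSpace.exp (rotGen u n q.1) * q.2.1 :=
      ((contDiff_exp_rotGen u n).comp contDiff_fst).mul (contDiff_fst.comp contDiff_snd)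
    have h2 : ContDiffOn ℝ ∞ (fun q : (ℝ × ℝ) × ((C3 →L[ℝ] C3) × E) ↦
        (NormedSpace.exp (rotGen u n q.1) * q.2.1, q.2.2)) N' :=
      (h1.prodMk (contDiff_snd.comp contDiff_snd)).contDiffOn
    have h3 := (contDiffOn_cdet_frame hv).comp h2 (fun q hq ↦ ⟨trivial, hq⟩)
    simpa only [Function.comp_def] using h3
  have hΩd : ∀ q ∈ N', DifferentiableAt ℝ Ω q := fun q hq ↦
    (hΩ.contDiffAt (hN'.mem_nhds hq)).differentiableAt (by simp)
  have hfd : ContinuousOn (fderiv ℝ Ω) N' := hΩ.continuousOn_fderiv_of_isOpen hN' (by simp)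
  let O := N' ∩ (fun q ↦ (fderiv ℝ Ω q).comp
    (ContinuousLinearMap.inl ℝ (ℝ × ℝ) ((C3 →L[ℝ] C3) × E))) ⁻¹' {A | Function.Surjective A}
  have hO : IsOpen O := ContinuousOn.isOpen_inter_preimage (by fun_prop) hN'
    ContinuousLinearMap.isOpen_setOf_surjective
  have hq₀ : ((0 : ℝ × ℝ), (A₀.1, y₀)) ∈ O := by
    refine ⟨hy₀, ?_⟩
    change Function.Surjective ((fderiv ℝ Ω (0, (A₀.1, y₀))).comp _)
    rw [← fderiv_comp_prodMk_left (hΩd (0, (A₀.1, y₀)) hy₀)]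
    exact hun
  have hpre : IsOpen ((fun z : (C3 →L[ℝ] C3) × E ↦ ((0 : ℝ × ℝ), z)) ⁻¹' O) :=
    hO.preimage (by fun_prop)
  obtain ⟨r, hr, hball⟩ := Metric.nhds_basis_closedBall.mem_iff.1 (hpre.mem_nhds hq₀)
  rw [← closedBall_prod_same] at hball
  have : ProperSpace E := FiniteDimensional.proper_real E
  have : ProperSpace (C3 →L[ℝ] C3) := FiniteDimensional.proper_real _
  set C := Metric.closedBall A₀.1 r ×ˢ Metric.closedBall y₀ r with hCdef
  have hC : IsCompact C := (isCompact_closedBall _ _).prod (isCompact_closedBall _ _)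
  have hCU : ∀ z ∈ C, z.2 ∈ U := fun z hz ↦ (hball hz).1
  have hCD : IsCompact (C ∩ degeneratePairs v U) :=
    hC.of_isClosed_subset (isClosed_degeneratePairs_inter hU hv hC.isClosed hCU) inter_subset_left
  let S : Set rotations := Subtype.val ⁻¹' (Prod.fst '' (C ∩ degeneratePairs v U))
  have hS : IsClosed S := (hCD.image continuous_fst).isClosed.preimage continuous_subtype_val
  refine ⟨(fun z : rotations × E ↦ (z.1.1, z.2)) ⁻¹' C,
    (by fun_prop : Continuous fun z : rotations × E ↦ (z.1.1, z.2)).continuousAt.preimage_mem_nhds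
      (prod_mem_nhds (Metric.closedBall_mem_nhds _ hr) (Metric.closedBall_mem_nhds _ hr)), ?_⟩
  refine IsNowhereDense.mono (s := S) ?_ (hS.isNowhereDense_iff.2 ?_)
  · rintro A ⟨y, hAy, hd⟩
    exact ⟨_, ⟨hAy, hd⟩, rfl⟩
  rw [eq_empty_iff_forall_notMem]
  intro A₁ hA₁
  have hA₁C : A₁.1 ∈ Metric.closedBall A₀.1 r := by
    obtain ⟨z, ⟨hz, -⟩, hzA⟩ := interior_subset hA₁
    rw [← hzA]; exact hz.1
  -- If `A₁` is interior to `S`, the family through `A₁` stays in `S` for all small parameters, so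
  -- the null set of transversality would be a neighbourhood of 0.
  let F : (ℝ × ℝ) × E → ℂ := fun z ↦ Ω (z.1, (A₁.1, z.2))
  let ι : (ℝ × ℝ) × E → (ℝ × ℝ) × ((C3 →L[ℝ] C3) × E) := fun z ↦ (z.1, (A₁.1, z.2))
  have hι : ContDiff ℝ ∞ ι := by fun_prop
  have hN₀ : IsOpen (ι ⁻¹' O) := hO.preimage hι.continuous
  have hF : ContDiffOn ℝ ∞ F (ι ⁻¹' O) := hΩ.comp hι.contDiffOn fun z hz ↦ hz.1
  have hFd : ∀ z ∈ ι ⁻¹' O, DifferentiableAt ℝ F z := fun z hz ↦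
    (hF.contDiffAt (hN₀.mem_nhds hz)).differentiableAt (by simp)
  have hnull := volume_image_singularZeros_eq_zero (Y := ℂ) hE (by simp) hN₀
    (hF.of_le ENat.LEInfty.out) (fun z hz ↦ by
      rw [← fderiv_comp_prodMk_left (x := z.1) (y := z.2) (hFd z hz)]
      have h1 : fderiv ℝ (fun x ↦ F (x, z.2)) z.1 = (fderiv ℝ Ω (ι z)).comp
          (ContinuousLinearMap.inl ℝ (ℝ × ℝ) ((C3 →L[ℝ] C3) × E)) :=
        fderiv_comp_prodMk_left (hΩd _ hz.1)
      rw [h1]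
      exact hz.2)
  have hmemO : ∀ y ∈ Metric.closedBall y₀ r, ((0 : ℝ × ℝ), y) ∈ ι ⁻¹' O := by
    intro y hy
    have h1 : (A₁.1, y) ∈ C := ⟨hA₁C, hy⟩
    have h2 : ((0 : ℝ × ℝ), (A₁.1, y)) ∈ O := hball h1
    exact h2
  clear_value O
  have hev1 : ∀ᶠ p in 𝓝 (0 : ℝ × ℝ), ∀ y ∈ Metric.closedBall y₀ r, (p, y) ∈ ι ⁻¹' O :=
    (isCompact_closedBall y₀ r).eventually_forall_of_forall_eventually
      (P := fun p y ↦ (p, y) ∈ ι ⁻¹' O) fun y hy ↦ hN₀.mem_nhds (hmemO y hy)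
  have hev2 : ∀ᶠ p in 𝓝 (0 : ℝ × ℝ), rotationFamily u n A₁ p ∈ S :=
    (continuous_rotationFamily u n A₁).continuousAt.eventually
      (by rw [rotationFamily_zero]; exact mem_interior_iff_mem_nhds.1 hA₁)
  have hmem : Prod.fst '' singularZeros F (ι ⁻¹' O) ∈ 𝓝 (0 : ℝ × ℝ) := by
    filter_upwards [hev1, hev2] with p hp1 hp2
    obtain ⟨⟨A, y⟩, ⟨⟨hA, hy⟩, -, hz0, hzn⟩, hzA⟩ := hp2
    obtain rfl : A = (rotationFamily u n A₁ p).1 := hzA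
    refine ⟨(p, y), ⟨hp1 y hy, hz0, ?_⟩, rfl⟩
    rw [← fderiv_comp_prodMk_right (hFd _ (hp1 y hy))]
    exact hzn
  exact (Measure.measure_pos_of_mem_nhds volume hmem).ne' hnull

/-- A generic rotation makes the determinant of a frame submersive at its zeros. -/
theorem setOf_submersive_mem_residual (hE : finrank ℝ E = 3) (hU : IsOpen U)
    (hv : ContDiffOn ℝ ∞ v U) (hind : ∀ y ∈ U, LinearIndependent ℝ (v y)) :
    {A : rotations | ∀ y ∈ U, cdet (fun i ↦ A.1 (v y i)) = 0 →
      Function.Surjective (fderiv ℝ (fun y ↦ cdet fun i ↦ A.1 (v y i)) y)} ∈ residual rotations := by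
  have : SecondCountableTopology (C3 →L[ℝ] C3) := by
    have : ProperSpace (C3 →L[ℝ] C3) := FiniteDimensional.proper_real _
    infer_instance
  have : SecondCountableTopology E := by
    have : ProperSpace E := FiniteDimensional.proper_real E
    infer_instance
  let Z : Set (rotations × E) := {z | z.2 ∈ U ∧ cdet (fun i ↦ z.1.1 (v z.2 i)) = 0}
  have hloc : ∀ z ∈ Z, ∃ t ∈ 𝓝 z, IsNowhereDense
      {A : rotations | ∃ y, (A, y) ∈ t ∧ (A.1, y) ∈ degeneratePairs v U} := fun z hz ↦
    exists_nhds_isNowhereDense_degenerate hE hU hv hind hz.1 hz.2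
  choose! t ht hnd using hloc
  obtain ⟨c, hcZ, hc, hcov⟩ := TopologicalSpace.countable_cover_nhdsWithin
    (f := t) (s := Z) (fun z hz ↦ mem_nhdsWithin_of_mem_nhds (ht z hz))
  have hres : ⋂ z ∈ c, {A : rotations | ∃ y, (A, y) ∈ t z ∧ (A.1, y) ∈ degeneratePairs v U}ᶜ ∈
      residual rotations :=
    (countable_bInter_mem hc).2 fun z hz ↦ (hnd z (hcZ hz)).isMeagre
  filter_upwards [hres] with A hA y hy h0
  by_contra hn
  obtain ⟨z, hz, hAz⟩ := mem_iUnion₂.1 (hcov (show (A, y) ∈ Z from ⟨hy, h0⟩))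
  exact mem_iInter₂.1 hA z hz ⟨y, hAz, hy, h0, hn⟩

/-- Completeness gives the Baire property, by which residual sets of rotations are dense. -/
instance : CompleteSpace rotations := isClosed_rotations.completeSpace_coe

end GenericRotation

/-! ### Straightening charts and smooth embeddings -/

section Manifolds

open Set Filter Topology Module

local notation "E3" => EuclideanSpace ℝ (Fin 3)

/-- The linear map that reads a real and a complex number as a point of `ℝ³`. -/
noncomputable def realComplexToEuclidean : ℝ × ℂ →L[ℝ] E3 :=
  LinearMap.toContinuousLinearMap
    { toFun := fun z ↦ WithLp.toLp 2 ![z.1, z.2.re, z.2.im]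
      map_add' := fun z w ↦ by ext i; fin_cases i <;> simp
      map_smul' := fun r z ↦ by ext i; fin_cases i <;> simp }

theorem realComplexToEuclidean_apply (z : ℝ × ℂ) :
    realComplexToEuclidean z = WithLp.toLp 2 ![z.1, z.2.re, z.2.im] := rfl

theorem realComplexToEuclidean_eq_zero {z : ℝ × ℂ} (h : realComplexToEuclidean z = 0) : z = 0 := by
  have h0 := congrArg (fun v : E3 ↦ v 0) h
  have h1 := congrArg (fun v : E3 ↦ v 1) h
  have h2 := congrArg (fun v : E3 ↦ v 2) h
  simp [realComplexToEuclidean_apply] at h0 h1 h2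
  exact Prod.ext h0 (Complex.ext h1 h2)

/-- The inverse function theorem, with smoothness on the whole domain of the local inverse. -/
theorem exists_openPartialHomeomorph_contDiffOn {E : Type*} [NormedAddCommGroup E]
    [NormedSpace ℝ E] [CompleteSpace E] {g : E → E} {U : Set E} (hU : IsOpen U)
    (hg : ContDiffOn ℝ ∞ g U) {x : E} (hx : x ∈ U) (hg' : IsUnit (fderiv ℝ g x)) :
    ∃ ψ : OpenPartialHomeomorph E E, x ∈ ψ.source ∧ ψ.source ⊆ U ∧ (∀ y, ψ y = g y) ∧
      ContDiffOn ℝ ∞ ψ ψ.source ∧ ContDiffOn ℝ ∞ ψ.symm ψ.target := by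
  have hcd : ∀ y ∈ U, ContDiffAt ℝ ∞ g y := fun y hy ↦ hg.contDiffAt (hU.mem_nhds hy)
  have hder : ∀ y ∈ U, IsUnit (fderiv ℝ g y) →
      ∃ e : E ≃L[ℝ] E, HasFDerivAt g (e : E →L[ℝ] E) y := by
    rintro y hy ⟨u, hu⟩
    refine ⟨ContinuousLinearEquiv.unitsEquiv ℝ E u, ?_⟩
    have h1 := ((hcd y hy).differentiableAt (by simp)).hasFDerivAt
    rw [← hu] at h1
    exact h1
  obtain ⟨e, he⟩ := hder x hx hg'
  set ψ₀ := (hcd x hx).toOpenPartialHomeomorph g he (by simp) with hψ₀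
  have hψ₀g : ∀ y, ψ₀ y = g y := fun y ↦ rfl
  have hV : IsOpen (U ∩ fderiv ℝ g ⁻¹' {A | IsUnit A}) :=
    (hg.continuousOn_fderiv_of_isOpen hU (by simp)).isOpen_inter_preimage hU Units.isOpen
  set V := U ∩ fderiv ℝ g ⁻¹' {A | IsUnit A}
  set ψ := ψ₀.restrOpen V hV
  have hsub : ψ.source ⊆ V := fun y hy ↦ hy.2
  have hψg : ∀ y, ψ y = g y := fun y ↦ rfl
  refine ⟨ψ, ⟨(hcd x hx).mem_toOpenPartialHomeomorph_source he (by simp), hx, hg'⟩,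
    fun y hy ↦ (hsub hy).1, hψg, ?_, ?_⟩
  · exact (hg.mono fun y hy ↦ (hsub hy).1).congr fun y _ ↦ hψg y
  · intro z hz
    have hy := hsub (ψ.map_target hz)
    obtain ⟨e', he'⟩ := hder _ hy.1 hy.2
    exact (ψ.contDiffAt_symm hz he' (hcd _ hy.1)).contDiffWithinAt

/-- The zero set of a submersion to `ℂ` is straightened by a local diffeomorphism of `ℝ³`. -/
theorem exists_straightening {g : E3 → ℂ} {U : Set E3} (hU : IsOpen U) (hg : ContDiffOn ℝ ∞ g U)
    {x : E3} (hx : x ∈ U) (hs : Function.Surjective (fderiv ℝ g x)) :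
    ∃ ψ : OpenPartialHomeomorph E3 E3, x ∈ ψ.source ∧ ψ.source ⊆ U ∧
      (∀ y, g y = 0 ↔ ψ y 1 = 0 ∧ ψ y 2 = 0) ∧
      ContDiffOn ℝ ∞ ψ ψ.source ∧ ContDiffOn ℝ ∞ ψ.symm ψ.target := by
  have hker : finrank ℝ (fderiv ℝ g x).ker = 1 := by
    have h1 := (fderiv ℝ g x).toLinearMap.finrank_range_add_finrank_ker
    rw [LinearMap.range_eq_top.2 hs, finrank_top] at h1
    simp at h1
    change finrank ℝ (fderiv ℝ g x).toLinearMap.ker = 1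
    omega
  obtain ⟨e, he0, he⟩ := finrank_eq_one_iff'.1 hker
  obtain ⟨q, hqe⟩ := SeparatingDual.exists_ne_zero (R := ℝ) (x := (e : E3)) (by simpa using he0)
  -- As `q` is injective on the kernel of the differential of `g`, the pair is a local
  -- diffeomorphism; its last two coordinates are the real and imaginary parts of `g`.
  let G : E3 → E3 := fun y ↦ realComplexToEuclidean (q y, g y)
  have hG : ContDiffOn ℝ ∞ G U :=
    realComplexToEuclidean.contDiff.comp_contDiffOn (q.contDiff.contDiffOn.prodMk hg)
  have hgd : HasFDerivAt g (fderiv ℝ g x) x :=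
    ((hg.contDiffAt (hU.mem_nhds hx)).differentiableAt (by simp)).hasFDerivAt
  have hGd : HasFDerivAt G (realComplexToEuclidean.comp (q.prod (fderiv ℝ g x))) x :=
    realComplexToEuclidean.hasFDerivAt.comp x (q.hasFDerivAt.prodMk hgd)
  have hinj : (fderiv ℝ G x).toLinearMap.ker = ⊥ := by
    rw [hGd.fderiv, LinearMap.ker_eq_bot']
    intro z hz
    obtain ⟨hqz, hgz⟩ := Prod.mk_eq_zero.1 (realComplexToEuclidean_eq_zero hz)
    obtain ⟨c, hc⟩ := he ⟨z, hgz⟩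
    have hc' : c • (e : E3) = z := congrArg Subtype.val hc
    have h1 : q z = 0 := hqz
    rw [← hc', map_smul, smul_eq_mul, mul_eq_zero, or_iff_left hqe] at h1
    rw [← hc', h1, zero_smul]
  have hunit : IsUnit (fderiv ℝ G x) := by
    let e' := (LinearEquiv.ofInjectiveEndo _ (LinearMap.ker_eq_bot.1 hinj)).toContinuousLinearEquiv
    refine ⟨(ContinuousLinearEquiv.unitsEquiv ℝ E3).symm e', ?_⟩
    ext1 z
    rfl
  obtain ⟨ψ, h1, h2, h3, h4, h5⟩ := exists_openPartialHomeomorph_contDiffOn hU hG hx hunit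
  refine ⟨ψ, h1, h2, fun y ↦ ?_, h4, h5⟩
  rw [h3]
  simp [G, realComplexToEuclidean_apply, Complex.ext_iff]

variable {M : Type*} [TopologicalSpace M] [ChartedSpace E3 M]

/-- A chart followed by a local diffeomorphism of the model space is a chart. -/
theorem trans_mem_maximalAtlas [IsManifold (𝓡 3) ∞ M] {φ : OpenPartialHomeomorph M E3}
    (hφ : φ ∈ IsManifold.maximalAtlas (𝓡 3) ∞ M) {ψ : OpenPartialHomeomorph E3 E3}
    (h : ContDiffOn ℝ ∞ ψ ψ.source) (h' : ContDiffOn ℝ ∞ ψ.symm ψ.target) :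
    φ ≫ₕ ψ ∈ IsManifold.maximalAtlas (𝓡 3) ∞ M := by
  have h1 : ContMDiffOn (𝓡 3) (𝓡 3) ∞ φ φ.source := contMDiffOn_of_mem_maximalAtlas hφ
  have h2 : ContMDiffOn (𝓡 3) (𝓡 3) ∞ φ.symm φ.target := contMDiffOn_symm_of_mem_maximalAtlas hφ
  have h3 : ContMDiffOn (𝓡 3) (𝓡 3) ∞ (φ ≫ₕ ψ) (φ ≫ₕ ψ).source :=
    h.contMDiffOn.comp (h1.mono fun x hx ↦ hx.1) fun x hx ↦ hx.2
  have h4 : ContMDiffOn (𝓡 3) (𝓡 3) ∞ (φ ≫ₕ ψ).symm (φ ≫ₕ ψ).target :=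
    h2.comp (h'.contMDiffOn.mono fun x hx ↦ hx.1) fun x hx ↦ hx.2
  exact OpenPartialHomeomorph.mem_maximalAtlas_of_contMDiffOn _ h3 h4

/-- A linear isomorphism composed with a smooth embedding is a smooth embedding. -/
theorem Manifold.IsSmoothEmbedding.continuousLinearEquiv_comp {f : M → C3}
    (hf : Manifold.IsSmoothEmbedding (𝓡 3) 𝓘(ℝ, C3) ∞ f) (l : C3 ≃L[ℝ] C3) :
    Manifold.IsSmoothEmbedding (𝓡 3) 𝓘(ℝ, C3) ∞ (l ∘ f) := by
  refine ⟨?_, l.toHomeomorph.isEmbedding.comp hf.isEmbedding⟩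
  obtain ⟨F, hF1, hF2, hF⟩ := hf.isImmersion
  refine ⟨F, hF1, hF2, fun x ↦ ?_⟩
  have h := hF x
  -- Undoing `l` before the target chart leaves the coordinate expression of the immersion
  -- unchanged.
  set c : OpenPartialHomeomorph C3 C3 := l.symm.toHomeomorph.toOpenPartialHomeomorph ≫ₕ h.codChart
  have hcs : ∀ y, l y ∈ c.source ↔ y ∈ h.codChart.source := fun y ↦ by simp [c]
  have hc : c ∈ IsManifold.maximalAtlas 𝓘(ℝ, C3) ∞ C3 := by
    have h1 : ContMDiffOn 𝓘(ℝ, C3) 𝓘(ℝ, C3) ∞ h.codChart h.codChart.source :=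
      contMDiffOn_of_mem_maximalAtlas h.codChart_mem_maximalAtlas
    have h2 : ContMDiffOn 𝓘(ℝ, C3) 𝓘(ℝ, C3) ∞ h.codChart.symm h.codChart.target :=
      contMDiffOn_symm_of_mem_maximalAtlas h.codChart_mem_maximalAtlas
    have h3 : ContMDiffOn 𝓘(ℝ, C3) 𝓘(ℝ, C3) ∞ c c.source :=
      h1.comp l.symm.contDiff.contMDiff.contMDiffOn fun x hx ↦ hx.2
    have h4 : ContMDiffOn 𝓘(ℝ, C3) 𝓘(ℝ, C3) ∞ c.symm c.target :=
      l.contDiff.contMDiff.comp_contMDiffOn (h2.mono fun x hx ↦ hx.1)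
    exact OpenPartialHomeomorph.mem_maximalAtlas_of_contMDiffOn _ h3 h4
  refine Manifold.IsImmersionAtOfComplement.mk_of_charts h.equiv h.domChart c
    h.mem_domChart_source ((hcs _).2 h.mem_codChart_source) h.domChart_mem_maximalAtlas hc
    (fun y hy ↦ (hcs _).2 (h.source_subset_preimage_source hy)) ?_
  intro y hy
  rw [← h.writtenInCharts hy]
  simp [c]

/-- In immersion charts the map is the inclusion of a factor, so projecting back gives a local left
inverse `R`, differentiable at `f x`; the chain rule concludes. -/
theorem Manifold.IsSmoothEmbedding.injective_mfderiv {f : M → C3}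
    (hf : Manifold.IsSmoothEmbedding (𝓡 3) 𝓘(ℝ, C3) ∞ f) (x : M) :
    Function.Injective (mfderiv (𝓡 3) 𝓘(ℝ, C3) f x) := by
  obtain ⟨F, hF1, hF2, hF⟩ := hf.isImmersion
  have h := hF x
  let p : C3 → E3 := fun z ↦ (h.equiv.symm (h.codChart z)).1
  let R : C3 → M := h.domChart.symm ∘ p
  have hp : ∀ y ∈ h.domChart.source, p (f y) = h.domChart y := by
    intro y hy
    have h0 : h.domChart y ∈ (h.domChart.extend (𝓡 3)).target := by
      simpa using h.domChart.map_source hy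
    have h1 := h.writtenInCharts h0
    simp only [Function.comp_apply, OpenPartialHomeomorph.extend_coe,
      OpenPartialHomeomorph.extend_coe_symm, modelWithCornersSelf_coe,
      modelWithCornersSelf_coe_symm, id_eq, h.domChart.left_inv hy] at h1
    simp [p, h1]
  have hpx : ContMDiffAt 𝓘(ℝ, C3) (𝓡 3) ∞ p (f x) := by
    have h1 := contMDiffAt_of_mem_maximalAtlas h.codChart_mem_maximalAtlas h.mem_codChart_source
    have h2 : ContDiff ℝ ∞ fun z : C3 ↦ (h.equiv.symm z).1 := by fun_prop
    exact h2.contMDiff.contMDiffAt.comp (f x) h1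
  have hR : MDifferentiableAt 𝓘(ℝ, C3) (𝓡 3) R (f x) := by
    have h1 : ContMDiffAt (𝓡 3) (𝓡 3) ∞ h.domChart.symm (p (f x)) := by
      rw [hp x h.mem_domChart_source]
      exact contMDiffAt_symm_of_mem_maximalAtlas h.domChart_mem_maximalAtlas
        (h.domChart.map_source h.mem_domChart_source)
    exact (h1.comp (f x) hpx).mdifferentiableAt (by simp)
  have hfd : MDifferentiableAt (𝓡 3) 𝓘(ℝ, C3) f x := (hf.contMDiff x).mdifferentiableAt (by simp)
  have hid : R ∘ f =ᶠ[𝓝 x] id := by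
    filter_upwards [h.domChart.open_source.mem_nhds h.mem_domChart_source] with y hy
    simp [R, hp y hy, h.domChart.left_inv hy]
  have hcomp : (mfderiv 𝓘(ℝ, C3) (𝓡 3) R (f x)).comp (mfderiv (𝓡 3) 𝓘(ℝ, C3) f x) =
      mfderiv (𝓡 3) (𝓡 3) (id : M → M) x := by
    rw [← mfderiv_comp x hR hfd]
    exact hid.mfderiv_eq
  intro a b hab
  have h1 : ∀ v, mfderiv 𝓘(ℝ, C3) (𝓡 3) R (f x) (mfderiv (𝓡 3) 𝓘(ℝ, C3) f x v) = v := fun v ↦ by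
    have := DFunLike.congr_fun hcomp v
    rw [mfderiv_id] at this
    exact this
  rw [← h1 a, hab, h1 b]

end Manifolds

/-! ### Complex tangents as zeros of the frame determinant -/

section ComplexTangents

open Set Filter Topology Module

local notation "E3" => EuclideanSpace ℝ (Fin 3)

variable {M : Type*} [TopologicalSpace M] [ChartedSpace E3 M] [IsManifold (𝓡 3) ∞ M]

/-- The frame of the tangent spaces of `f` given by the coordinate fields of a chart. -/
noncomputable def coordinateFrame (f : M → C3) (φ : OpenPartialHomeomorph M E3) (y : E3)
    (i : Fin 3) : C3 :=
  fderiv ℝ (f ∘ φ.symm) y (EuclideanSpace.single i 1)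

theorem single_eq_basisFun : (fun i : Fin 3 ↦ (EuclideanSpace.single i (1 : ℝ) : E3)) =
    (EuclideanSpace.basisFun (Fin 3) ℝ).toBasis := by
  funext i
  rw [OrthonormalBasis.coe_toBasis, EuclideanSpace.basisFun_apply]

section

variable {f : M → C3} (hf : Manifold.IsSmoothEmbedding (𝓡 3) 𝓘(ℝ, C3) ∞ f)
include hf

theorem contDiffOn_comp_chart_symm (x₀ : M) :
    ContDiffOn ℝ ∞ (f ∘ (chartAt E3 x₀).symm) (chartAt E3 x₀).target :=
  (hf.contMDiff.comp_contMDiffOn (contMDiffOn_chart_symm (x := x₀))).contDiffOn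

theorem contDiffOn_coordinateFrame (x₀ : M) :
    ContDiffOn ℝ ∞ (coordinateFrame f (chartAt E3 x₀)) (chartAt E3 x₀).target := by
  refine contDiffOn_pi.2 fun i ↦ ?_
  have h1 : ContDiffOn ℝ ∞ (fderiv ℝ (f ∘ (chartAt E3 x₀).symm)) (chartAt E3 x₀).target :=
    (contDiffOn_comp_chart_symm hf x₀).fderiv_of_isOpen (chartAt E3 x₀).open_target (by simp)
  exact h1.clm_apply contDiffOn_const

theorem fderiv_comp_chart_symm (x₀ : M) {y : E3} (hy : y ∈ (chartAt E3 x₀).target) :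
    fderiv ℝ (f ∘ (chartAt E3 x₀).symm) y =
      (mfderiv (𝓡 3) 𝓘(ℝ, C3) f ((chartAt E3 x₀).symm y) : E3 →L[ℝ] C3).comp
        (mfderiv (𝓡 3) (𝓡 3) (chartAt E3 x₀).symm y : E3 →L[ℝ] E3) := by
  rw [← mfderiv_eq_fderiv]
  exact mfderiv_comp y ((hf.contMDiff _).mdifferentiableAt (by simp))
    ((mdifferentiable_chart x₀).mdifferentiableAt_symm hy)

theorem linearIndependent_coordinateFrame (x₀ : M) {y : E3} (hy : y ∈ (chartAt E3 x₀).target) :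
    LinearIndependent ℝ (coordinateFrame f (chartAt E3 x₀) y) := by
  have hinj : Function.Injective (fderiv ℝ (f ∘ (chartAt E3 x₀).symm) y) := by
    rw [fderiv_comp_chart_symm hf x₀ hy]
    exact (hf.injective_mfderiv _).comp
      ((mdifferentiable_chart (I := 𝓡 3) x₀).symm.mfderiv_injective hy)
  have h1 : LinearIndependent ℝ fun i : Fin 3 ↦ (EuclideanSpace.single i (1 : ℝ) : E3) := by
    rw [single_eq_basisFun]
    exact (EuclideanSpace.basisFun (Fin 3) ℝ).toBasis.linearIndependent
  exact h1.map' (fderiv ℝ (f ∘ (chartAt E3 x₀).symm) y).toLinearMap (LinearMap.ker_eq_bot.2 hinj)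

theorem span_coordinateFrame (x₀ : M) {y : E3} (hy : y ∈ (chartAt E3 x₀).target) :
    Submodule.span ℝ (range (coordinateFrame f (chartAt E3 x₀) y)) =
      tangentPlane f ((chartAt E3 x₀).symm y) := by
  have h1 : Submodule.span ℝ (range fun i : Fin 3 ↦ (EuclideanSpace.single i (1 : ℝ) : E3)) = ⊤ := by
    rw [single_eq_basisFun]
    exact (EuclideanSpace.basisFun (Fin 3) ℝ).toBasis.span_eq
  have h2 : range (coordinateFrame f (chartAt E3 x₀) y) =
      (fderiv ℝ (f ∘ (chartAt E3 x₀).symm) y).toLinearMap ''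
        range fun i : Fin 3 ↦ (EuclideanSpace.single i (1 : ℝ) : E3) := by
    rw [← range_comp]
    rfl
  rw [h2, Submodule.span_image, h1, Submodule.map_top, fderiv_comp_chart_symm hf x₀ hy]
  refine LinearMap.range_comp_of_range_eq_top
    (f := (mfderiv (𝓡 3) (𝓡 3) (chartAt E3 x₀).symm y : E3 →L[ℝ] E3).toLinearMap) _ ?_
  exact LinearMap.range_eq_top.2
    ((mdifferentiable_chart (I := 𝓡 3) x₀).symm.mfderiv_surjective hy)

theorem mem_complexTangents_iff (x₀ : M) {x : M} (hx : x ∈ (chartAt E3 x₀).source) :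
    x ∈ complexTangents f ↔
      cdet (coordinateFrame f (chartAt E3 x₀) (chartAt E3 x₀ x)) = 0 := by
  have hy := (chartAt E3 x₀).map_source hx
  rw [cdet_eq_zero_iff (linearIndependent_coordinateFrame hf x₀ hy), span_coordinateFrame hf x₀ hy,
    (chartAt E3 x₀).left_inv hx]
  rfl

/-- If the determinants of the coordinate frames are submersive at their zeros, then the complex
tangents form a smooth curve. -/
theorem isSmoothCurveIn_complexTangents
    (h : ∀ x₀ : M, ∃ x₁ : M, x₀ ∈ (chartAt E3 x₁).source ∧ ∀ y ∈ (chartAt E3 x₁).target,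
      cdet (coordinateFrame f (chartAt E3 x₁) y) = 0 →
        Function.Surjective (fderiv ℝ (fun y ↦ cdet (coordinateFrame f (chartAt E3 x₁) y)) y)) :
    IsSmoothCurveIn (complexTangents f) := by
  intro x hx
  obtain ⟨x₁, hx₁, hs⟩ := h x
  set φ := chartAt E3 x₁
  have hg : ContDiffOn ℝ ∞ (fun y ↦ cdet (coordinateFrame f φ y)) φ.target :=
    contDiff_cdet.comp_contDiffOn (contDiffOn_coordinateFrame hf x₁)
  have hφx := φ.map_source hx₁
  obtain ⟨ψ, hxψ, -, hzero, hψ, hψ'⟩ := exists_straightening φ.open_target hg hφx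
    (hs _ hφx ((mem_complexTangents_iff hf x₁ hx₁).1 hx))
  refine ⟨φ ≫ₕ ψ, trans_mem_maximalAtlas (IsManifold.chart_mem_maximalAtlas x₁) hψ hψ',
    ⟨hx₁, hxψ⟩, fun y hy ↦ ?_⟩
  rw [mem_complexTangents_iff hf x₁ hy.1, hzero]
  rfl

end

theorem coordinateFrame_comp {f : M → C3}
    (hf : Manifold.IsSmoothEmbedding (𝓡 3) 𝓘(ℝ, C3) ∞ f) (l : C3 →L[ℝ] C3) (x₀ : M) {y : E3}
    (hy : y ∈ (chartAt E3 x₀).target) (i : Fin 3) :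
    coordinateFrame (l ∘ f) (chartAt E3 x₀) y i = l (coordinateFrame f (chartAt E3 x₀) y i) := by
  have h1 : HasFDerivAt (f ∘ (chartAt E3 x₀).symm) (fderiv ℝ (f ∘ (chartAt E3 x₀).symm) y) y :=
    (((contDiffOn_comp_chart_symm hf x₀).contDiffAt
      ((chartAt E3 x₀).open_target.mem_nhds hy)).differentiableAt (by simp)).hasFDerivAt
  have h2 := (l.hasFDerivAt.comp y h1).fderiv
  rw [coordinateFrame, Function.comp_assoc, h2]
  rfl

/-- The isometry of `ℂ³` given by a rotation operator. -/
noncomputable def rotationEquiv (A : rotations) : C3 ≃ₗᵢ[ℝ] C3 :=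
  (⟨A.1.toLinearMap, A.2.1⟩ : C3 →ₗᵢ[ℝ] C3).toLinearIsometryEquiv rfl

theorem isRotation_rotationEquiv (A : rotations) : IsRotation (rotationEquiv A) := by
  rw [IsRotation, ← A.2.2]
  congr 1

theorem exists_rotation_near_one {P : Set rotations} (hP : P ∈ residual rotations) {ε : ℝ}
    (hε : 0 < ε) : ∃ A ∈ P, ‖A.1 - 1‖ < ε := by
  have hO : IsOpen {A : rotations | ‖A.1 - 1‖ < ε} :=
    isOpen_lt (by fun_prop) continuous_const
  obtain ⟨A, hA, hAP⟩ := (dense_of_mem_residual hP).inter_open_nonempty _ hO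
    ⟨⟨1, one_mem_rotations⟩, by simpa using hε⟩
  exact ⟨A, hAP, hA⟩

end ComplexTangents

theorem proposition3 {M : Type*} [TopologicalSpace M]
    [ChartedSpace (EuclideanSpace ℝ (Fin 3)) M] [IsManifold (𝓡 3) ∞ M]
    (f : M → C3) (hf : Manifold.IsSmoothEmbedding (𝓡 3) 𝓘(ℝ, C3) ∞ f)
    (ε : ℝ) (hε : 0 < ε) :
    ∃ l : C3 ≃ₗᵢ[ℝ] C3, IsRotation l ∧
      ‖(l.toContinuousLinearEquiv : C3 →L[ℝ] C3) - ContinuousLinearMap.id ℝ C3‖ < ε ∧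
      Manifold.IsSmoothEmbedding (𝓡 3) 𝓘(ℝ, C3) ∞ (l ∘ f) ∧
      (IsTotallyReal (l ∘ f) ∨
        ((complexTangents (l ∘ f)).Nonempty ∧ IsSmoothCurveIn (complexTangents (l ∘ f)))) := by
  have : SecondCountableTopology C3 := by
    have : ProperSpace C3 := FiniteDimensional.proper_real _
    infer_instance
  -- The embedding makes countably many charts enough, and residual sets are stable under countable
  -- intersections.
  have : SecondCountableTopology M := hf.isEmbedding.secondCountableTopology
  obtain ⟨s, hs, hcov⟩ := TopologicalSpace.countable_cover_nhds
    (f := fun x : M ↦ (chartAt (EuclideanSpace ℝ (Fin 3)) x).source) (chart_source_mem_nhds _)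
  have hres := (countable_bInter_mem hs).2 fun x₁ _ ↦
    setOf_submersive_mem_residual (by simp) (chartAt (EuclideanSpace ℝ (Fin 3)) x₁).open_target
      (contDiffOn_coordinateFrame hf x₁) fun y hy ↦ linearIndependent_coordinateFrame hf x₁ hy
  obtain ⟨A, hA, hAε⟩ := exists_rotation_near_one hres hε
  have hl : Manifold.IsSmoothEmbedding (𝓡 3) 𝓘(ℝ, C3) ∞ (rotationEquiv A ∘ f) :=
    hf.continuousLinearEquiv_comp (rotationEquiv A).toContinuousLinearEquiv
  refine ⟨rotationEquiv A, isRotation_rotationEquiv A, hAε, hl, ?_⟩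
  rcases (complexTangents (rotationEquiv A ∘ f)).eq_empty_or_nonempty with h0 | h0
  · exact Or.inl h0
  refine Or.inr ⟨h0, isSmoothCurveIn_complexTangents hl fun x₀ ↦ ?_⟩
  obtain ⟨x₁, hx₁, hx₀⟩ := Set.mem_iUnion₂.1 (hcov.symm ▸ Set.mem_univ x₀)
  have hframe : ∀ y ∈ (chartAt (EuclideanSpace ℝ (Fin 3)) x₁).target,
      cdet (coordinateFrame (rotationEquiv A ∘ f) (chartAt _ x₁) y) =
        cdet fun i ↦ A.1 (coordinateFrame f (chartAt _ x₁) y i) := fun y hy ↦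
    congrArg cdet (funext fun i ↦ coordinateFrame_comp hf A.1 x₁ hy i)
  refine ⟨x₁, hx₀, fun y hy hy0 ↦ ?_⟩
  have hev : (fun y ↦ cdet (coordinateFrame (rotationEquiv A ∘ f) (chartAt _ x₁) y)) =ᶠ[nhds y]
      fun y ↦ cdet fun i ↦ A.1 (coordinateFrame f (chartAt _ x₁) y i) := by
    filter_upwards [(chartAt _ x₁).open_target.mem_nhds hy] with z hz using hframe z hz
  rw [hev.fderiv_eq]
  exact Set.mem_iInter₂.1 hA x₁ hx₁ y hy (by rw [← hframe y hy, hy0])
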